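/- Let $M$ be a smooth manifold (Hausdorff, second countable, without boundary) of dimension $2n+1$, $n\ge 0$, and let $\rho:G\times M\to M$ be a smooth action of a compact Lie group $G$, with normalized Haar measure $\eta$. All vector fields, forms and metrics are smooth. Definitions. A contact form is a 1-form $\alpha$ with $\alpha\wedge(d\alpha)^n$ nowhere zero; its Reeb field $R$ is determined by $\langle R\rangle=\ker d\alpha$ and $\alpha(R)=1$; a vector field $X$ is Reeb-like for $\alpha$ if $X=hR$ for a smooth function $h>0$. For a Riemannian metric $g$ and a volume form (nowhere vanishing top-degree form) $\mu$, $\mathrm{curl}\,X$ is the vector field with $\iota_{\mathrm{curl}\,X}\,\mu=(d\iota_Xg)^n$. The field $X$ is nonsingular Beltrami on $(M,g,\mu)$ if $\mathcal L_X\mu=0$ and $\mathrm{curl}\,X=fX$ for a function $f$, where neither $X$ nor $f$ vanishes at any point. Invariance means $\rho_{\sigma*}X=X$, $\rho_\sigma^*\alpha=\alpha$, $\rho_\sigma^*g=g$ for all $\sigma\in G$. (1) Let $X$ be nonsingular Beltrami on $(M,g,\mu)$ for some volume form $\mu$, with $X$ and $g$ both $G$-invariant. Then $\iota_Xg$ is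 a $G$-invariant contact form, and $X$ is Reeb-like for it. (2) Conversely, let $X$ be Reeb-like for a contact form $\alpha$, with $X$ and $\alpha$ both $G$-invariant. Then there are a Riemannian metric $\tilde g$ with $\iota_X\tilde g=\alpha$ and a volume form $\mu$ such that the Haar average $g=\int_G\rho_\sigma^*\tilde g\,d\eta(\sigma)$ is a $G$-invariant Riemannian metric with $\iota_Xg=\alpha$, and $X$ is nonsingular Beltrami on $(M,g,\mu)$ with $\mathrm{curl}\,X=X$. -/

import Mathlib

open scoped Manifold ContDiff Bundle
open MeasureTheory

noncomputable section

namespace ReebBeltrami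

/-! ### Multilinear algebra on one tangent space -/

section LinearAlgebra

variable {V : Type*} [AddCommGroup V] [Module ℝ V] [TopologicalSpace V]

/-- The wedge product `a ∧ b` of alternating forms: the sum over all `(p, q)`-shuffles `σ` of
`sign σ * a (v_{σ 1}, …, v_{σ p}) * b (v_{σ (p+1)}, …, v_{σ (p+q)})`.
No factorials occur, which is the normalization matching `extDeriv`. -/
def wedge {p q : ℕ} (a : V [⋀^Fin p]→L[ℝ] ℝ) (b : V [⋀^Fin q]→L[ℝ] ℝ) :
    V [⋀^Fin (p + q)]→L[ℝ] ℝ :=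
  { ((LinearMap.mul' ℝ ℝ).compAlternatingMap
      (a.toAlternatingMap.domCoprod b.toAlternatingMap)).domDomCongr finSumFinEquiv with
    cont := by
      have h : ∀ v : Fin (p + q) → V,
          (((LinearMap.mul' ℝ ℝ).compAlternatingMap
            (a.toAlternatingMap.domCoprod b.toAlternatingMap)).domDomCongr finSumFinEquiv) v =
          ∑ σ : Equiv.Perm.ModSumCongr (Fin p) (Fin q),
            LinearMap.mul' ℝ ℝ (AlternatingMap.domCoprod.summand a.toAlternatingMap
              b.toAlternatingMap σ (fun i => v (finSumFinEquiv i))) := by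
        intro v
        simp [AlternatingMap.domCoprod_apply, map_sum, Function.comp_def]
      refine Continuous.congr ?_ fun v => (h v).symm
      refine continuous_finsetSum _ fun σ _ => ?_
      induction σ using Quotient.inductionOn' with | _ σ
      have h' : ∀ v : Fin (p + q) → V,
          LinearMap.mul' ℝ ℝ (AlternatingMap.domCoprod.summand a.toAlternatingMap
            b.toAlternatingMap (Quotient.mk'' σ) (fun i => v (finSumFinEquiv i))) =
          (Equiv.Perm.sign σ : ℤ) • (a (fun i => v (finSumFinEquiv (σ (Sum.inl i)))) *
            b (fun i => v (finSumFinEquiv (σ (Sum.inr i))))) := by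
        intro v
        rw [AlternatingMap.domCoprod.summand_mk'', smul_apply,
          Units.smul_def, map_zsmul]
        rfl
      refine Continuous.congr ?_ fun v => (h' v).symm
      have ha : Continuous fun v : Fin (p + q) → V =>
          a (fun i => v (finSumFinEquiv (σ (Sum.inl i)))) :=
        a.cont.comp (continuous_pi fun i => continuous_apply _)
      have hb : Continuous fun v : Fin (p + q) → V =>
          b (fun i => v (finSumFinEquiv (σ (Sum.inr i)))) :=
        b.cont.comp (continuous_pi fun i => continuous_apply _)
      exact Continuous.const_smul (ha.mul hb) (Equiv.Perm.sign σ : ℤ) }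

/-- The `n`-th wedge power `θ ∧ … ∧ θ` of a 2-form; the `0`-th power is the constant `1`. -/
def wedgePow (θ : V [⋀^Fin 2]→L[ℝ] ℝ) : (n : ℕ) → V [⋀^Fin (2 * n)]→L[ℝ] ℝ
  | 0 => ContinuousAlternatingMap.constOfIsEmpty ℝ V (Fin 0) 1
  | n + 1 => wedge (wedgePow θ n) θ

/-- The interior product `ι_v θ = θ (v, ·, …, ·)`. -/
def contract {k : ℕ} (v : V) (θ : V [⋀^Fin (k + 1)]→L[ℝ] ℝ) : V [⋀^Fin k]→L[ℝ] ℝ :=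
  { θ.toAlternatingMap.curryLeft v with
    cont := θ.cont.comp (Continuous.finCons continuous_const continuous_id) }

end LinearAlgebra

/-! ### Differential forms, vector fields and metrics on an `m`-manifold -/

section Manifold

variable {m : ℕ} {M : Type*} [TopologicalSpace M] [ChartedSpace (EuclideanSpace ℝ (Fin m)) M]

/-- A (not necessarily smooth) vector field on the `m`-manifold `M`. -/
abbrev VField (m : ℕ) (M : Type*) [TopologicalSpace M]
    [ChartedSpace (EuclideanSpace ℝ (Fin m)) M] : Type _ :=
  (x : M) → TangentSpace (𝓡 m) x

/-- A (not necessarily smooth) differential `k`-form on the `m`-manifold `M`. -/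
abbrev DForm (m : ℕ) (M : Type*) [TopologicalSpace M]
    [ChartedSpace (EuclideanSpace ℝ (Fin m)) M] (k : ℕ) : Type _ :=
  (x : M) → TangentSpace (𝓡 m) x [⋀^Fin k]→L[ℝ] ℝ

/-- A smooth Riemannian metric on `M`. -/
abbrev Metric (m : ℕ) (M : Type*) [TopologicalSpace M]
    [ChartedSpace (EuclideanSpace ℝ (Fin m)) M] [IsManifold (𝓡 m) ∞ M] : Type _ :=
  Bundle.ContMDiffRiemannianMetric (𝓡 m) ∞ (EuclideanSpace ℝ (Fin m))
    (fun x : M => TangentSpace (𝓡 m) x)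

/-- Smoothness of a vector field, as a section of the tangent bundle. -/
def SmoothVField [IsManifold (𝓡 m) ∞ M] (X : VField m M) : Prop :=
  ContMDiff (𝓡 m) (𝓡 m).tangent ∞ (fun x => (⟨x, X x⟩ : TangentBundle (𝓡 m) M))

/-- The form `θ` read in the chart around `x₀`, that is, its pullback under the inverse of
that chart; it is meaningful on the target of the chart. -/
def inChart {k : ℕ} (θ : DForm m M k) (x₀ : M) (y : EuclideanSpace ℝ (Fin m)) :
    EuclideanSpace ℝ (Fin m) [⋀^Fin k]→L[ℝ] ℝ :=
  (θ ((extChartAt (𝓡 m) x₀).symm y)).compContinuousLinearMap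
    (mfderiv 𝓘(ℝ, EuclideanSpace ℝ (Fin m)) (𝓡 m) (extChartAt (𝓡 m) x₀).symm y)

/-- Smoothness of a differential form, in the charts of the manifold. -/
def SmoothForm {k : ℕ} (θ : DForm m M k) : Prop :=
  ∀ x₀ : M, ContDiffOn ℝ ∞ (inChart θ x₀) (extChartAt (𝓡 m) x₀).target

/-- The exterior derivative `dθ` of a differential form: at `x`, read `θ` in the chart around
`x`, take the exterior derivative in Euclidean space, and pull back under the chart. -/
def extd {k : ℕ} (θ : DForm m M k) : DForm m M (k + 1) := fun x =>
  (extDeriv (inChart θ x) (extChartAt (𝓡 m) x x)).compContinuousLinearMap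
    (mfderiv (𝓡 m) 𝓘(ℝ, EuclideanSpace ℝ (Fin m)) (extChartAt (𝓡 m) x) x)

/-- The interior product `ι_X θ` of a form with a vector field. -/
def interiorProduct {k : ℕ} (X : VField m M) (θ : DForm m M (k + 1)) : DForm m M k :=
  fun x => contract (X x) (θ x)

/-- The Lie derivative `L_X θ = d ι_X θ + ι_X dθ` of a form of positive degree. -/
def lieDeriv {k : ℕ} (X : VField m M) (θ : DForm m M (k + 1)) : DForm m M (k + 1) :=
  fun x => extd (interiorProduct X θ) x + interiorProduct X (extd θ) x

/-- A volume form on an `m`-manifold: a smooth, nowhere vanishing `m`-form. -/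
def IsVolumeForm (μ : DForm m M m) : Prop :=
  SmoothForm μ ∧ ∀ x, μ x ≠ 0

/-- The 1-form `ι_X g = g (X, ·)`. -/
def flat [IsManifold (𝓡 m) ∞ M] (g : Metric m M) (X : VField m M) : DForm m M 1 :=
  fun x => ContinuousAlternatingMap.ofSubsingleton ℝ (TangentSpace (𝓡 m) x) ℝ (0 : Fin 1)
    (g.inner x (X x))

end Manifold

/-! ### Contact forms and Beltrami fields on a `(2n+1)`-manifold -/

section Odd

variable {n : ℕ} {M : Type*} [TopologicalSpace M]
  [ChartedSpace (EuclideanSpace ℝ (Fin (2 * n + 1))) M]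

/-- A contact form: a smooth 1-form with `α ∧ (dα)^n` nowhere zero. -/
def IsContactForm (α : DForm (2 * n + 1) M 1) : Prop :=
  SmoothForm α ∧ ∀ x, wedge (α x) (wedgePow (extd α x) n) ≠ 0

/-- `R` is the Reeb field of `α`: the smooth vector field with `ker dα = ⟨R⟩` and `α (R) = 1`. -/
def IsReebField [IsManifold (𝓡 (2 * n + 1)) ∞ M] (α : DForm (2 * n + 1) M 1)
    (R : VField (2 * n + 1) M) : Prop :=
  SmoothVField R ∧
    ∀ x, (∀ v : TangentSpace (𝓡 (2 * n + 1)) x,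
        contract v (extd α x) = 0 ↔ v ∈ Submodule.span ℝ {R x}) ∧
      α x (fun _ => R x) = 1

/-- `X` is Reeb-like for the contact form `α`: `X = h R` for the Reeb field `R` of `α` and some
smooth function `h > 0`. -/
def IsReebLike [IsManifold (𝓡 (2 * n + 1)) ∞ M] (α : DForm (2 * n + 1) M 1)
    (X : VField (2 * n + 1) M) : Prop :=
  IsContactForm α ∧ ∃ (R : VField (2 * n + 1) M) (h : M → ℝ),
    IsReebField α R ∧ ContMDiff (𝓡 (2 * n + 1)) 𝓘(ℝ, ℝ) ∞ h ∧ (∀ x, 0 < h x) ∧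
      ∀ x, X x = h x • R x

/-- `Y` is the curl of `X` with respect to `g` and `μ`: `ι_Y μ = (d ι_X g)^n`. As the volume form
`μ` is nondegenerate, at most one vector field `Y` satisfies this. -/
def IsCurl [IsManifold (𝓡 (2 * n + 1)) ∞ M] (g : Metric (2 * n + 1) M)
    (μ : DForm (2 * n + 1) M (2 * n + 1)) (X Y : VField (2 * n + 1) M) : Prop :=
  ∀ x, interiorProduct Y μ x = wedgePow (extd (flat g X) x) n

/-- `X` is a nonsingular Beltrami field on `(M, g, μ)` with proportionality factor `f`: a smooth
vector field with `L_X μ = 0` and `curl X = f X`, where `X` and `f` vanish nowhere. -/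
structure IsNonsingularBeltrami [IsManifold (𝓡 (2 * n + 1)) ∞ M] (g : Metric (2 * n + 1) M)
    (μ : DForm (2 * n + 1) M (2 * n + 1)) (f : M → ℝ) (X : VField (2 * n + 1) M) : Prop where
  smooth : SmoothVField X
  volumeForm : IsVolumeForm μ
  divergenceFree : ∀ x, lieDeriv X μ x = 0
  curl_eq : IsCurl g μ X (fun x => f x • X x)
  field_ne_zero : ∀ x, X x ≠ 0
  factor_ne_zero : ∀ x, f x ≠ 0

end Odd

/-! ### Invariance under a group action and averaging -/

section Action

variable {m : ℕ} {M : Type*} [TopologicalSpace M] [ChartedSpace (EuclideanSpace ℝ (Fin m)) M]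

/-- The differential at `x` of the map `ρ_σ : M → M`, `y ↦ σ • y`. -/
def actionDeriv {G : Type*} [SMul G M] (σ : G) (x : M) :
    TangentSpace (𝓡 m) x →L[ℝ] TangentSpace (𝓡 m) (σ • x) :=
  mfderiv (𝓡 m) (𝓡 m) (fun y : M => σ • y) x

/-- `X` is `G`-invariant: `ρ_{σ*} X = X` for all `σ`. -/
def InvariantVField (G : Type*) [SMul G M] (X : VField m M) : Prop :=
  ∀ (σ : G) (x : M), actionDeriv σ x (X x) = X (σ • x)

/-- `θ` is `G`-invariant: `ρ_σ^* θ = θ` for all `σ`. -/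
def InvariantForm (G : Type*) [SMul G M] {k : ℕ} (θ : DForm m M k) : Prop :=
  ∀ (σ : G) (x : M), (θ (σ • x)).compContinuousLinearMap (actionDeriv σ x) = θ x

/-- `g` is `G`-invariant: `ρ_σ^* g = g` for all `σ`. -/
def InvariantMetric [IsManifold (𝓡 m) ∞ M] (G : Type*) [SMul G M] (g : Metric m M) : Prop :=
  ∀ (σ : G) (x : M) (v w : TangentSpace (𝓡 m) x),
    g.inner (σ • x) (actionDeriv σ x v) (actionDeriv σ x w) = g.inner x v w

/-- `g` is the average `∫_G ρ_σ^* g₀ dη(σ)` of `g₀` with respect to the measure `η` on `G`. -/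
def IsAverage [IsManifold (𝓡 m) ∞ M] {G : Type*} [SMul G M] [MeasurableSpace G] (η : Measure G)
    (g₀ g : Metric m M) : Prop :=
  ∀ (x : M) (v w : TangentSpace (𝓡 m) x),
    g.inner x v w = ∫ σ : G, g₀.inner (σ • x) (actionDeriv σ x v) (actionDeriv σ x w) ∂η

end Action

end ReebBeltrami

end

/-! Part (1). Put `α = ι_X g` and `y = f X`, so that `(dα)ⁿ = ι_y μ`. Any vector in `ker dα` also
annihilates `(dα)ⁿ`, and the kernel of `ι_y μ` is the line of `y` because `μ` is nondegenerate. As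
`dα` is a 2-form in odd dimension, its kernel is nonzero, hence equal to that line
(`contract_eq_zero_iff_of_wedgePow_eq`). Since `α(y) = f g(X, X) ≠ 0`, the form `α ∧ ι_y μ` does not
vanish (`wedge_contract_ne_zero`), so `α` is contact. Its Reeb field is `X / g(X, X)`, and `X` is
`g(X, X)` times it.

Part (2). Let `X = h R`. With any auxiliary metric `k` and the projection `P = id - α ⊗ R` onto `ker
α`, the form `h⁻¹ α ⊗ α + k(P·, P·)` is a metric `g₀` with `ι_X g₀ = α` (`exists_metric_flat_eq`).
Averaging keeps this identity: by invariance of `X` and `α` the integrand defining `g(X, v)` is the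
constant `α(v)` (`IsAverage.flat_eq`). Take `μ = h⁻¹ α ∧ (dα)ⁿ`. As `ι_X dα = 0` and `α(X) = h`,
contraction gives `ι_X μ = (dα)ⁿ`, which is `curl X = X`. The same identity gives `L_X μ = d (dα)ⁿ =
0`, since `dμ` vanishes for degree reasons (`IsReebLike.exists_isNonsingularBeltrami`).

The remaining work is foundational: wedge products of closed forms are closed, `d` is independent of
the chart, metrics exist, and averages over a compact group are smooth. -/

noncomputable section

namespace ReebBeltrami

open Set Topology

/-! ### Wedge products as signed sums over permutations; null vectors of forms. -/

section LinearAlgebra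

variable {V : Type*} [AddCommGroup V] [Module ℝ V] [TopologicalSpace V]

/-- Each shuffle class contains `p! q!` permutations, all contributing the same term. Sums over the
full symmetric group can be reindexed freely, which is why later arguments use this form of the
wedge product. -/
theorem wedge_apply_perm {p q : ℕ} (a : V [⋀^Fin p]→L[ℝ] ℝ) (b : V [⋀^Fin q]→L[ℝ] ℝ)
    (v : Fin (p + q) → V) :
    ((p.factorial * q.factorial : ℕ) : ℝ) * wedge a b v =
      ∑ σ : Equiv.Perm (Fin (p + q)), ((Equiv.Perm.sign σ : ℤ) : ℝ) *
        (a (fun i => v (σ (Fin.castAdd q i))) * b (fun j => v (σ (Fin.natAdd p j)))) := by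
  have h := congrArg (fun f => LinearMap.mul' ℝ ℝ (f (fun i => v (finSumFinEquiv i))))
    (MultilinearMap.domCoprod_alternization_eq a.toAlternatingMap b.toAlternatingMap)
  have h1 : wedge a b v = LinearMap.mul' ℝ ℝ
      (a.toAlternatingMap.domCoprod b.toAlternatingMap (fun i => v (finSumFinEquiv i))) := rfl
  rw [h1, ← nsmul_eq_mul, ← map_nsmul]
  simp only [Fintype.card_fin, AlternatingMap.smul_apply] at h
  rw [← h, MultilinearMap.alternatization_apply, map_sum]
  refine Fintype.sum_equiv finSumFinEquiv.permCongr _ _ fun σ => ?_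
  rw [Equiv.Perm.sign_permCongr]
  rcases Int.units_eq_one_or (Equiv.Perm.sign σ) with h | h <;>
    simp [h, MultilinearMap.domCoprod_apply, Equiv.permCongr_apply]

omit [TopologicalSpace V] in
-- Group the permutations by `i = σ 0`: the other arguments are `v` without its `i`-th entry,
-- permuted by some `e`. Alternation of `A (v i)` absorbs the sign of `e`, so the `p!` choices of
-- `e` contribute equally.
theorem sum_perm_uncurry {p : ℕ} (A : V →ₗ[ℝ] V [⋀^Fin p]→ₗ[ℝ] ℝ) (v : Fin (p + 1) → V) :
    ∑ σ : Equiv.Perm (Fin (p + 1)), ((Equiv.Perm.sign σ : ℤ) : ℝ) *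
        A (v (σ 0)) (fun i => v (σ i.succ)) =
      p.factorial * AlternatingMap.alternatizeUncurryFin A v := by
  -- The permutation with `0 ↦ i` and `k.succ ↦ i.succAbove (e k)`; its sign is `(-1)^i` times that
  -- of `e`.
  let F : Fin (p + 1) × Equiv.Perm (Fin p) → Equiv.Perm (Fin (p + 1)) :=
    fun x => x.1.cycleRange⁻¹ * Equiv.Perm.decomposeFin.symm (0, x.2)
  have h0 : ∀ x, F x 0 = x.1 := fun x => by simp [F, Equiv.Perm.inv_def]
  have hs : ∀ x i, F x (Fin.succ i) = x.1.succAbove (x.2 i) := fun x i => by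
    simp [F, Equiv.Perm.inv_def]
  have hF : Function.Bijective F := by
    rw [Fintype.bijective_iff_injective_and_card]
    constructor
    · rintro ⟨i, e⟩ ⟨j, e'⟩ h
      have hi : i = j := (h0 (i, e)).symm.trans ((congrArg (fun f => f 0) h).trans (h0 (j, e')))
      subst hi
      refine Prod.ext rfl (Equiv.ext fun k => ?_)
      have := hs (i, e) k
      rw [h, hs] at this
      exact (Fin.succAbove_right_injective this).symm
    · simp [Fintype.card_perm, Nat.factorial_succ]
  rw [← (Equiv.ofBijective F hF).sum_comp, Fintype.sum_prod_type,
    AlternatingMap.alternatizeUncurryFin_apply, Finset.mul_sum]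
  refine Finset.sum_congr rfl fun i _ => ?_
  have : ∀ e : Equiv.Perm (Fin p), ((Equiv.Perm.sign (F (i, e)) : ℤ) : ℝ) *
      A (v (F (i, e) 0)) (fun k => v (F (i, e) k.succ)) =
      (-1) ^ (i : ℕ) • A (v i) (i.removeNth v) := by
    intro e
    simp only [h0, hs]
    have h2 : (fun k => v (i.succAbove (e k))) = (i.removeNth v) ∘ e := rfl
    rw [h2, AlternatingMap.map_perm]
    simp only [F, Equiv.Perm.sign_mul, Equiv.Perm.sign_inv, Fin.sign_cycleRange,
      Equiv.Perm.decomposeFin.symm_sign]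
    rcases Int.units_eq_one_or (Equiv.Perm.sign e) with h | h <;> simp [h, Units.smul_def]
  simp only [Equiv.ofBijective_apply, this]
  simp [Fintype.card_perm]

/-- `v` can be inserted anywhere in `a` only to give zero. -/
def IsNull {k : ℕ} (v : V) (a : V [⋀^Fin k]→L[ℝ] ℝ) : Prop :=
  ∀ (u : Fin k → V) (i : Fin k), u i = v → a u = 0

theorem isNull_of_contract_eq_zero {k : ℕ} {v : V} {a : V [⋀^Fin (k + 1)]→L[ℝ] ℝ}
    (h : contract v a = 0) : IsNull v a := by
  intro u i hi
  have h1 : a (Fin.cons v (Fin.tail (u ∘ Equiv.swap 0 i))) = 0 :=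
    congrArg (fun f => f (Fin.tail (u ∘ Equiv.swap 0 i))) h
  have h2 : Fin.cons v (Fin.tail (u ∘ Equiv.swap 0 i)) = u ∘ Equiv.swap 0 i := by
    conv_rhs => rw [← Fin.cons_self_tail (u ∘ Equiv.swap 0 i)]
    simp [hi]
  rw [h2] at h1
  have h3 := a.toAlternatingMap.map_perm u (Equiv.swap 0 i)
  have h4 : a.toAlternatingMap (u ∘ Equiv.swap 0 i) = 0 := h1
  rw [h4, eq_comm, Units.smul_def] at h3
  exact (smul_eq_zero.mp h3).resolve_left (by simp)

theorem contract_apply {k : ℕ} (v : V) (a : V [⋀^Fin (k + 1)]→L[ℝ] ℝ) (u : Fin k → V) :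
    contract v a u = a (Fin.cons v u) := rfl

theorem IsNull.wedge {p q : ℕ} {v : V} {a : V [⋀^Fin p]→L[ℝ] ℝ} {b : V [⋀^Fin q]→L[ℝ] ℝ}
    (ha : IsNull v a) (hb : IsNull v b) : IsNull v (wedge a b) := by
  intro u i hi
  have h := wedge_apply_perm a b u
  rw [Finset.sum_eq_zero] at h
  · exact (mul_eq_zero.mp h).resolve_left (by positivity)
  · intro σ _
    obtain ⟨j, rfl⟩ := σ.surjective i
    induction j using Fin.addCases with
    | left j => rw [ha _ j hi]; ring
    | right j => rw [hb _ j hi]; ring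

theorem IsNull.wedgePow {v : V} {θ : V [⋀^Fin 2]→L[ℝ] ℝ} (h : IsNull v θ) (n : ℕ) :
    IsNull v (wedgePow θ n) := by
  induction n with
  | zero => exact fun _ i => i.elim0
  | succ n ih => exact ih.wedge h

/-- A form of degree one as a linear map. -/
def oneFormLin (α : V [⋀^Fin 1]→L[ℝ] ℝ) : V →ₗ[ℝ] ℝ where
  toFun u := α (fun _ => u)
  map_add' x y := by
    have h : ∀ z : V, Function.update (fun _ : Fin 1 => (0 : V)) 0 z = fun _ => z := fun z => by
      ext i; simp [Subsingleton.elim i 0]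
    simpa only [h] using α.map_update_add (fun _ => 0) 0 x y
  map_smul' c x := by
    have h : ∀ z : V, Function.update (fun _ : Fin 1 => (0 : V)) 0 z = fun _ => z := fun z => by
      ext i; simp [Subsingleton.elim i 0]
    simpa only [h, RingHom.id_apply] using α.map_update_smul (fun _ => 0) 0 c x

theorem oneFormLin_apply (α : V [⋀^Fin 1]→L[ℝ] ℝ) (x : V) :
    oneFormLin α x = α (fun _ => x) := rfl

/-- The expansion along the 1-form is `sum_perm_uncurry` for the map `x ↦ α(x) b`; the cast
reconciles the degrees `1 + q` and `q + 1`. -/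
theorem wedge_one_left {q : ℕ} (α : V [⋀^Fin 1]→L[ℝ] ℝ) (b : V [⋀^Fin q]→L[ℝ] ℝ)
    (v : Fin (q + 1) → V) :
    wedge α b (v ∘ Fin.cast (Nat.add_comm 1 q)) =
      ∑ i : Fin (q + 1), (-1) ^ (i : ℕ) * (α (fun _ => v i) * b (i.removeNth v)) := by
  have h := wedge_apply_perm α b (v ∘ Fin.cast (Nat.add_comm 1 q))
  let A : V →ₗ[ℝ] V [⋀^Fin q]→ₗ[ℝ] ℝ := (oneFormLin α).smulRight b.toAlternatingMap
  have hA : ∀ x u, A x u = α (fun _ => x) * b u := fun _ _ => rfl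
  have h2 := sum_perm_uncurry A v
  rw [AlternatingMap.alternatizeUncurryFin_apply] at h2
  have h3 : (q.factorial : ℝ) ≠ 0 := by positivity
  refine mul_left_cancel₀ h3 ?_
  simp only [hA, zsmul_eq_mul, Int.cast_pow, Int.cast_neg, Int.cast_one] at h2
  simp only [Nat.factorial_one, one_mul] at h
  rw [h]
  refine Eq.trans ?_ h2
  refine Fintype.sum_equiv (finCongr (Nat.add_comm 1 q)).permCongr _ _ fun σ => ?_
  rw [Equiv.Perm.sign_permCongr]
  congr 2
  · congr 1
    ext i
    simp [Equiv.permCongr_apply, Subsingleton.elim i 0]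
    rfl
  · congr 1
    ext i
    have : Fin.natAdd 1 i = Fin.cast (Nat.add_comm q 1) i.succ := by ext; simp [Nat.add_comm]
    simp [Equiv.permCongr_apply, this]

/-- In every term except `i = 0` the vector `x` remains among the arguments of `b`, which kills the
term. -/
theorem wedge_one_left_cons {q : ℕ} (α : V [⋀^Fin 1]→L[ℝ] ℝ) {b : V [⋀^Fin q]→L[ℝ] ℝ} {x : V}
    (hb : IsNull x b) (w : Fin q → V) :
    wedge α b ((Fin.cons x w : Fin (q + 1) → V) ∘ Fin.cast (Nat.add_comm 1 q)) =
      α (fun _ => x) * b w := by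
  rw [wedge_one_left, Fin.sum_univ_succ, Finset.sum_eq_zero]
  · simp [Fin.removeNth_zero]
  · intro i _
    cases q with
    | zero => exact i.elim0
    | succ q => rw [hb _ 0 (by simp [Fin.removeNth])]; ring

end LinearAlgebra

/-! ### Reindexing signed sums over a symmetric group. -/

section Permutations

/-- Summation over cosets of the subgroup permuting the image of `ι`: right translation by each of
its `k!` elements preserves the total, so `k!` times the total is a sum of vanishing inner sums. -/
theorem sum_perm_eq_zero_of_embedding {J : Type*} [Fintype J] [DecidableEq J] {k : ℕ}
    (ι : Fin k ↪ J) (X : Equiv.Perm J → ℝ)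
    (h : ∀ σ, ∑ e : Equiv.Perm (Fin k), ((Equiv.Perm.sign e : ℤ) : ℝ) *
      X (σ * e.viaFintypeEmbedding ι) = 0) :
    ∑ σ, ((Equiv.Perm.sign σ : ℤ) : ℝ) * X σ = 0 := by
  have h1 : ∀ e : Equiv.Perm (Fin k), ∑ σ, ((Equiv.Perm.sign σ : ℤ) : ℝ) * X σ =
      ∑ σ : Equiv.Perm J, ((Equiv.Perm.sign σ : ℤ) : ℝ) *
        (((Equiv.Perm.sign e : ℤ) : ℝ) * X (σ * e.viaFintypeEmbedding ι)) := by
    intro e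
    rw [← Equiv.sum_comp (Equiv.mulRight (e.viaFintypeEmbedding ι))]
    refine Finset.sum_congr rfl fun σ _ => ?_
    simp [Equiv.Perm.viaFintypeEmbedding_sign, mul_assoc]
  have h2 : ∑ _e : Equiv.Perm (Fin k), ∑ σ, ((Equiv.Perm.sign σ : ℤ) : ℝ) * X σ = 0 := by
    rw [Finset.sum_congr rfl fun e _ => h1 e, Finset.sum_comm]
    refine Finset.sum_eq_zero fun σ _ => ?_
    rw [← Finset.mul_sum, h, mul_zero]
  rw [Finset.sum_const, smul_eq_zero] at h2
  exact h2.resolve_left (by simp [Fintype.card_perm, Nat.factorial_ne_zero])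

theorem sum_perm_mul_decomposeFin {m : ℕ} (X : Equiv.Perm (Fin (m + 1)) → ℝ)
    (τ : Equiv.Perm (Fin m)) :
    ∑ σ, ((Equiv.Perm.sign σ : ℤ) : ℝ) * (((Equiv.Perm.sign τ : ℤ) : ℝ) *
      X (σ * Equiv.Perm.decomposeFin.symm (0, τ))) =
    ∑ σ, ((Equiv.Perm.sign σ : ℤ) : ℝ) * X σ := by
  conv_rhs => rw [← Equiv.sum_comp (Equiv.mulRight (Equiv.Perm.decomposeFin.symm (0, τ)))]
  refine Finset.sum_congr rfl fun σ _ => ?_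
  simp [Equiv.Perm.decomposeFin.symm_sign, mul_assoc]

end Permutations

/-! ### Bilinearity and pullback of the wedge; the algebra behind the Leibniz rule. -/

section LinearAlgebra

variable {V : Type*} [AddCommGroup V] [Module ℝ V] [TopologicalSpace V]

theorem eq_of_factorial_mul_eq {p q : ℕ} {x y : ℝ}
    (h : ((p.factorial * q.factorial : ℕ) : ℝ) * x = ((p.factorial * q.factorial : ℕ) : ℝ) * y) :
    x = y :=
  mul_left_cancel₀ (by positivity) h

/-- The wedge product as a bilinear map. -/
def wedgeLin (V : Type*) [AddCommGroup V] [Module ℝ V] [TopologicalSpace V] (p q : ℕ) :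
    (V [⋀^Fin p]→L[ℝ] ℝ) →ₗ[ℝ] (V [⋀^Fin q]→L[ℝ] ℝ) →ₗ[ℝ] (V [⋀^Fin (p + q)]→L[ℝ] ℝ) :=
  LinearMap.mk₂ ℝ wedge
    (fun a a' b => by
      ext v
      refine eq_of_factorial_mul_eq (p := p) (q := q) ?_
      simp only [ContinuousAlternatingMap.add_apply, mul_add, add_mul, wedge_apply_perm,
        Finset.sum_add_distrib])
    (fun c a b => by
      ext v
      refine eq_of_factorial_mul_eq (p := p) (q := q) ?_
      simp only [ContinuousAlternatingMap.smul_apply, smul_eq_mul, mul_left_comm _ c, mul_assoc,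
        wedge_apply_perm, ← Finset.mul_sum])
    (fun a b b' => by
      ext v
      refine eq_of_factorial_mul_eq (p := p) (q := q) ?_
      simp only [ContinuousAlternatingMap.add_apply, mul_add, wedge_apply_perm,
        Finset.sum_add_distrib])
    (fun c a b => by
      ext v
      refine eq_of_factorial_mul_eq (p := p) (q := q) ?_
      simp only [ContinuousAlternatingMap.smul_apply, smul_eq_mul, mul_left_comm _ c,
        wedge_apply_perm, ← Finset.mul_sum])

theorem wedge_compContinuousLinearMap {W : Type*} [AddCommGroup W] [Module ℝ W]
    [TopologicalSpace W] {p q : ℕ} (a : V [⋀^Fin p]→L[ℝ] ℝ) (b : V [⋀^Fin q]→L[ℝ] ℝ)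
    (f : W →L[ℝ] V) :
    (wedge a b).compContinuousLinearMap f =
      wedge (a.compContinuousLinearMap f) (b.compContinuousLinearMap f) := by
  ext v
  refine eq_of_factorial_mul_eq (p := p) (q := q) ?_
  rw [wedge_apply_perm, ContinuousAlternatingMap.compContinuousLinearMap_apply, wedge_apply_perm]
  rfl

theorem wedgePow_compContinuousLinearMap {W : Type*} [AddCommGroup W] [Module ℝ W]
    [TopologicalSpace W] (θ : V [⋀^Fin 2]→L[ℝ] ℝ) (f : W →L[ℝ] V) (n : ℕ) :
    (wedgePow θ n).compContinuousLinearMap f = wedgePow (θ.compContinuousLinearMap f) n := by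
  induction n with
  | zero => ext v; rfl
  | succ n ih => exact (wedge_compContinuousLinearMap _ _ f).trans (by rw [ih]; rfl)

/-- Expanding both the alternatization and the wedge costs only nonzero factorials and leaves one
signed sum over all permutations of the `p + q + 1` arguments. -/
theorem sum_wedge_eq_zero_of_perm {p q : ℕ} (C : V →ₗ[ℝ] V [⋀^Fin (p + q)]→ₗ[ℝ] ℝ)
    (a : V → V [⋀^Fin p]→L[ℝ] ℝ) (b : V → V [⋀^Fin q]→L[ℝ] ℝ)
    (hC : ∀ u v, C u v = wedge (a u) (b u) v) (v : Fin (p + q + 1) → V)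
    (h : ∑ σ : Equiv.Perm (Fin (p + q + 1)), ((Equiv.Perm.sign σ : ℤ) : ℝ) *
      (a (v (σ 0)) (fun i => v (σ (Fin.castAdd q i).succ)) *
        b (v (σ 0)) (fun j => v (σ (Fin.natAdd p j).succ))) = 0) :
    AlternatingMap.alternatizeUncurryFin C v = 0 := by
  have h1 := sum_perm_uncurry C v
  have h2 : ((p.factorial * q.factorial : ℕ) : ℝ) *
      (((p + q).factorial : ℝ) * AlternatingMap.alternatizeUncurryFin C v) = 0 := by
    rw [← h1, Finset.mul_sum]
    simp only [hC, mul_left_comm ((p.factorial * q.factorial : ℕ) : ℝ), wedge_apply_perm]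
    simp only [Finset.mul_sum]
    rw [Finset.sum_comm]
    refine Finset.sum_eq_zero fun τ _ => ?_
    refine Eq.trans ?_ ((sum_perm_mul_decomposeFin (fun σ =>
      a (v (σ 0)) (fun i => v (σ (Fin.castAdd q i).succ)) *
        b (v (σ 0)) (fun j => v (σ (Fin.natAdd p j).succ))) τ).trans h)
    simp
  have h3 : ((p.factorial * q.factorial : ℕ) : ℝ) ≠ 0 := by positivity
  have h4 : (((p + q).factorial : ℕ) : ℝ) ≠ 0 := by positivity
  simpa [h3, h4, Nat.factorial_ne_zero] using h2

/-- With `A` the derivative of a form, this is the half of the Leibniz rule in which `a` is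
differentiated, for closed `a`. Permuting only the derivative slot and the `p` slots of `a` leaves
the arguments of `b` fixed, so each coset sum is a multiple of the alternatization of `A`. -/
theorem alternatize_wedge_left_eq_zero {p q : ℕ} (A : V →ₗ[ℝ] V [⋀^Fin p]→ₗ[ℝ] ℝ)
    (C : V →ₗ[ℝ] V [⋀^Fin (p + q)]→ₗ[ℝ] ℝ)
    (a : V → V [⋀^Fin p]→L[ℝ] ℝ) (b : V [⋀^Fin q]→L[ℝ] ℝ) (ha : ∀ u v, A u v = a u v)
    (hC : ∀ u v, C u v = wedge (a u) b v) (hA : AlternatingMap.alternatizeUncurryFin A = 0) :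
    AlternatingMap.alternatizeUncurryFin C = 0 := by
  ext v
  refine sum_wedge_eq_zero_of_perm C a (fun _ => b) hC v ?_
  -- Slot `0` carries the direction of differentiation; the other points of the image are the slots
  -- of `a`.
  let ι : Fin (p + 1) ↪ Fin (p + q + 1) :=
    ⟨Fin.cons 0 fun i => (Fin.castAdd q i).succ, by
      rw [Fin.cons_injective_iff]
      exact ⟨by simp [Set.mem_range, Fin.succ_ne_zero],
        (Fin.succ_injective _).comp (Fin.castAdd_injective _ _)⟩⟩
  have hι0 : ι 0 = 0 := rfl
  have hιs : ∀ i : Fin p, ι i.succ = (Fin.castAdd q i).succ := fun _ => rfl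
  refine sum_perm_eq_zero_of_embedding ι _ fun σ => ?_
  have hout : ∀ (e : Equiv.Perm (Fin (p + 1))) (j : Fin q),
      e.viaFintypeEmbedding ι (Fin.natAdd p j).succ = (Fin.natAdd p j).succ := by
    intro e j
    refine Equiv.Perm.viaFintypeEmbedding_apply_notMem_range _ _ ?_
    rintro ⟨i, hi⟩
    induction i using Fin.cases with
    | zero => exact Fin.succ_ne_zero _ hi.symm
    | succ i =>
      rw [hιs, Fin.succ_inj] at hi
      have := congrArg Fin.val hi
      simp at this
      omega
  have hin : ∀ (e : Equiv.Perm (Fin (p + 1))) i, e.viaFintypeEmbedding ι (ι i) = ι (e i) :=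
    fun e i => Equiv.Perm.viaFintypeEmbedding_apply_image _ _ _
  simp only [Equiv.Perm.mul_apply, hout, ← hι0, ← hιs, hin]
  simp only [← mul_assoc, ← Finset.sum_mul]
  have := sum_perm_uncurry A (fun i => v (σ (ι i)))
  simp only [ha] at this
  rw [this, hA]
  simp

theorem alternatize_wedge_right_eq_zero {p q : ℕ} (B : V →ₗ[ℝ] V [⋀^Fin q]→ₗ[ℝ] ℝ)
    (C : V →ₗ[ℝ] V [⋀^Fin (p + q)]→ₗ[ℝ] ℝ)
    (a : V [⋀^Fin p]→L[ℝ] ℝ) (b : V → V [⋀^Fin q]→L[ℝ] ℝ) (hb : ∀ u v, B u v = b u v)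
    (hC : ∀ u v, C u v = wedge a (b u) v) (hB : AlternatingMap.alternatizeUncurryFin B = 0) :
    AlternatingMap.alternatizeUncurryFin C = 0 := by
  ext v
  refine sum_wedge_eq_zero_of_perm C (fun _ => a) b hC v ?_
  let ι : Fin (q + 1) ↪ Fin (p + q + 1) :=
    ⟨Fin.cons 0 fun i => (Fin.natAdd p i).succ, by
      rw [Fin.cons_injective_iff]
      exact ⟨by simp [Set.mem_range, Fin.succ_ne_zero],
        (Fin.succ_injective _).comp (Fin.natAdd_injective _ _)⟩⟩
  have hι0 : ι 0 = 0 := rfl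
  have hιs : ∀ i : Fin q, ι i.succ = (Fin.natAdd p i).succ := fun _ => rfl
  refine sum_perm_eq_zero_of_embedding ι _ fun σ => ?_
  have hout : ∀ (e : Equiv.Perm (Fin (q + 1))) (j : Fin p),
      e.viaFintypeEmbedding ι (Fin.castAdd q j).succ = (Fin.castAdd q j).succ := by
    intro e j
    refine Equiv.Perm.viaFintypeEmbedding_apply_notMem_range _ _ ?_
    rintro ⟨i, hi⟩
    induction i using Fin.cases with
    | zero => exact Fin.succ_ne_zero _ hi.symm
    | succ i =>
      rw [hιs, Fin.succ_inj] at hi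
      have := congrArg Fin.val hi
      simp at this
      omega
  have hin : ∀ (e : Equiv.Perm (Fin (q + 1))) i, e.viaFintypeEmbedding ι (ι i) = ι (e i) :=
    fun e i => Equiv.Perm.viaFintypeEmbedding_apply_image _ _ _
  simp only [Equiv.Perm.mul_apply, hout, ← hι0, ← hιs, hin]
  simp only [mul_left_comm _ (a _), ← Finset.mul_sum]
  have := sum_perm_uncurry B (fun i => v (σ (ι i)))
  simp only [hb] at this
  rw [this, hB]
  simp

end LinearAlgebra

/-! ### Exterior derivatives of wedge products in a vector space. -/

section Calculus

variable {E : Type*} [NormedAddCommGroup E] [NormedSpace ℝ E] [FiniteDimensional ℝ E]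

instance finiteDimensional_continuousAlternatingMap (k : ℕ) :
    FiniteDimensional ℝ (E [⋀^Fin k]→L[ℝ] ℝ) :=
  Module.Finite.of_injective
    ({ toFun := fun f => f.toMultilinearMap
       map_add' := fun _ _ => rfl
       map_smul' := fun _ _ => rfl } :
      (E [⋀^Fin k]→L[ℝ] ℝ) →ₗ[ℝ] MultilinearMap ℝ (fun _ : Fin k => E) ℝ)
    fun f g h => by
      ext v
      exact congrArg (fun F : MultilinearMap ℝ (fun _ : Fin k => E) ℝ => F v) h

variable (E) in
/-- The wedge product as a continuous bilinear map. -/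
def wedgeCLM (p q : ℕ) :
    (E [⋀^Fin p]→L[ℝ] ℝ) →L[ℝ] (E [⋀^Fin q]→L[ℝ] ℝ) →L[ℝ] (E [⋀^Fin (p + q)]→L[ℝ] ℝ) :=
  (wedgeLin E p q).toContinuousBilinearMap

omit [FiniteDimensional ℝ E] in
theorem contDiffOn_bilinear {A B F : Type*} [NormedAddCommGroup A] [NormedSpace ℝ A]
    [NormedAddCommGroup B] [NormedSpace ℝ B] [NormedAddCommGroup F] [NormedSpace ℝ F]
    (L : A →L[ℝ] B →L[ℝ] F) {k : ℕ∞ω} {s : Set E} {a : E → A} {b : E → B}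
    (ha : ContDiffOn ℝ k a s) (hb : ContDiffOn ℝ k b s) :
    ContDiffOn ℝ k (fun y => L (a y) (b y)) s :=
  L.isBoundedBilinearMap.contDiff.comp_contDiffOn (ha.prodMk hb)

theorem contDiffOn_wedge {F : Type*} [NormedAddCommGroup F] [NormedSpace ℝ F] {p q : ℕ}
    {k : ℕ∞ω} {s : Set F} {a : F → E [⋀^Fin p]→L[ℝ] ℝ} {b : F → E [⋀^Fin q]→L[ℝ] ℝ}
    (ha : ContDiffOn ℝ k a s) (hb : ContDiffOn ℝ k b s) :
    ContDiffOn ℝ k (fun y => wedge (a y) (b y)) s :=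
  contDiffOn_bilinear (wedgeCLM E p q) ha hb

theorem contDiffOn_wedgePow {F : Type*} [NormedAddCommGroup F] [NormedSpace ℝ F]
    {k : ℕ∞ω} {s : Set F} {θ : F → E [⋀^Fin 2]→L[ℝ] ℝ} (h : ContDiffOn ℝ k θ s) (n : ℕ) :
    ContDiffOn ℝ k (fun y => wedgePow (θ y) n) s := by
  induction n with
  | zero => exact contDiffOn_const
  | succ n ih => exact contDiffOn_wedge ih h

theorem hasFDerivAt_wedge {p q : ℕ} {x : E} {a : E → E [⋀^Fin p]→L[ℝ] ℝ}
    {b : E → E [⋀^Fin q]→L[ℝ] ℝ} (ha : DifferentiableAt ℝ a x) (hb : DifferentiableAt ℝ b x) :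
    HasFDerivAt (fun y => wedge (a y) (b y))
      ((wedgeCLM E p q).precompR E (a x) (fderiv ℝ b x) +
        (wedgeCLM E p q).precompL E (fderiv ℝ a x) (b x)) x :=
  (wedgeCLM E p q).hasFDerivAt_of_bilinear ha.hasFDerivAt hb.hasFDerivAt

/-- The product rule splits the derivative into two summands, and alternatization kills each of them
separately; the signed Leibniz formula is not needed. -/
theorem extDeriv_wedge_eq_zero {p q : ℕ} {x : E} {a : E → E [⋀^Fin p]→L[ℝ] ℝ}
    {b : E → E [⋀^Fin q]→L[ℝ] ℝ} (ha : DifferentiableAt ℝ a x) (hb : DifferentiableAt ℝ b x)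
    (ha0 : extDeriv a x = 0) (hb0 : extDeriv b x = 0) :
    extDeriv (fun y => wedge (a y) (b y)) x = 0 := by
  let lin {k : ℕ} (L : E →L[ℝ] E [⋀^Fin k]→L[ℝ] ℝ) : E →ₗ[ℝ] E [⋀^Fin k]→ₗ[ℝ] ℝ :=
    ContinuousAlternatingMap.toAlternatingMapLinear ∘ₗ L.toLinearMap
  have hlin : ∀ {k : ℕ} (L : E →L[ℝ] E [⋀^Fin k]→L[ℝ] ℝ) (v : Fin (k + 1) → E),
      ContinuousAlternatingMap.alternatizeUncurryFin L v =
        AlternatingMap.alternatizeUncurryFin (lin L) v := by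
    intro k L v
    rw [ContinuousAlternatingMap.alternatizeUncurryFin_apply,
      AlternatingMap.alternatizeUncurryFin_apply]
    rfl
  have hA : AlternatingMap.alternatizeUncurryFin (lin (fderiv ℝ a x)) = 0 := by
    ext v
    rw [← hlin]
    exact congrArg (fun f => f v) ha0
  have hB : AlternatingMap.alternatizeUncurryFin (lin (fderiv ℝ b x)) = 0 := by
    ext v
    rw [← hlin]
    exact congrArg (fun f => f v) hb0
  ext v
  rw [extDeriv, (hasFDerivAt_wedge ha hb).fderiv,
    ContinuousAlternatingMap.alternatizeUncurryFin_add,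
    ContinuousAlternatingMap.add_apply, hlin, hlin,
    alternatize_wedge_right_eq_zero (lin (fderiv ℝ b x)) _ (a x) (fderiv ℝ b x)
      (fun _ _ => rfl) (fun _ _ => rfl) hB,
    alternatize_wedge_left_eq_zero (lin (fderiv ℝ a x)) _ (fderiv ℝ a x) (b x)
      (fun _ _ => rfl) (fun _ _ => rfl) hA]
  simp

theorem differentiableAt_wedgePow {x : E} {θ : E → E [⋀^Fin 2]→L[ℝ] ℝ}
    (h : DifferentiableAt ℝ θ x) (n : ℕ) : DifferentiableAt ℝ (fun y => wedgePow (θ y) n) x := by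
  induction n with
  | zero => exact differentiableAt_const _
  | succ n ih => exact (hasFDerivAt_wedge ih h).differentiableAt

theorem extDeriv_wedgePow_eq_zero {x : E} {θ : E → E [⋀^Fin 2]→L[ℝ] ℝ}
    (h : DifferentiableAt ℝ θ x) (h0 : extDeriv θ x = 0) (n : ℕ) :
    extDeriv (fun y => wedgePow (θ y) n) x = 0 := by
  induction n with
  | zero => exact (extDeriv_constOfIsEmpty (fun _ : E => (1 : ℝ)) x).trans (by ext; simp)
  | succ n ih => exact extDeriv_wedge_eq_zero (differentiableAt_wedgePow h n) h ih h0

end Calculus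

/-! ### Kernels of 2-forms in odd dimension and nondegeneracy of top forms. -/

section TopForms

variable {V : Type*} [AddCommGroup V] [Module ℝ V] [TopologicalSpace V] [FiniteDimensional ℝ V]

/-- The Gram matrix of `θ` is skew of odd size, so its determinant equals its own negative and
vanishes. A vector in the left kernel gives the coordinates of `v`. -/
theorem exists_ne_zero_contract_eq_zero {n : ℕ} (hV : Module.finrank ℝ V = 2 * n + 1)
    (θ : V [⋀^Fin 2]→L[ℝ] ℝ) : ∃ v : V, v ≠ 0 ∧ contract v θ = 0 := by
  let b : Module.Basis (Fin (2 * n + 1)) ℝ V := (Module.finBasis ℝ V).reindex (finCongr hV)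
  let A : Matrix (Fin (2 * n + 1)) (Fin (2 * n + 1)) ℝ := Matrix.of fun i j => θ ![b i, b j]
  have hskew : A.transpose = -A := by
    ext i j
    have h := θ.toAlternatingMap.map_swap ![b i, b j] (zero_ne_one (α := Fin 2))
    have h2 : ![b i, b j] ∘ Equiv.swap (0 : Fin 2) 1 = ![b j, b i] := by
      ext k; fin_cases k <;> simp
    rw [h2] at h
    exact h
  have hdet : A.det = 0 := by
    have h := congrArg Matrix.det hskew
    rw [Matrix.det_transpose, Matrix.det_neg, Fintype.card_fin, pow_succ, pow_mul] at h
    norm_num at h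
    linarith
  obtain ⟨c, hc, hAc⟩ := Matrix.exists_vecMul_eq_zero_iff.mpr hdet
  refine ⟨∑ i, c i • b i, fun h0 => hc ?_, ?_⟩
  · ext i
    exact Fintype.linearIndependent_iff.mp b.linearIndependent c h0 i
  · have hL : (contract (∑ i, c i • b i) θ).toAlternatingMap = 0 := by
      refine b.ext_alternating fun k _ => ?_
      change contract (∑ i, c i • b i) θ _ = 0
      have hk : ∀ x : V, (Fin.cons x (fun i => b (k i)) : Fin 2 → V) = ![x, b (k 0)] := fun x => by
        ext i; fin_cases i <;> simp
      have hcons : ∀ x y : V, (Fin.cons x (fun _ => y) : Fin 2 → V) = ![x, y] := fun x y => by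
        ext i; fin_cases i <;> simp
      have h1 : ∀ x : V, contract x θ (fun i => b (k i)) =
          (oneFormLin (contract (b (k 0)) θ)) (-x) := by
        intro x
        have h := θ.toAlternatingMap.map_swap ![b (k 0), x] (zero_ne_one (α := Fin 2))
        have h2 : ![b (k 0), x] ∘ Equiv.swap (0 : Fin 2) 1 = ![x, b (k 0)] := by
          ext k; fin_cases k <;> simp
        rw [h2] at h
        rw [map_neg, oneFormLin_apply, contract_apply, contract_apply, hcons, hk]
        exact h
      rw [h1, map_neg, map_sum, neg_eq_zero]
      have h2 := congrFun hAc (k 0)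
      simp only [Matrix.vecMul, dotProduct, A, Matrix.of_apply, Pi.zero_apply] at h2
      rw [← neg_eq_zero, ← h2, ← Finset.sum_neg_distrib]
      refine Finset.sum_congr rfl fun i _ => ?_
      rw [map_smul, smul_eq_mul, ← mul_neg, ← map_neg, ← h1, contract_apply, hk]
    ext u
    exact congrArg (fun f => f u) hL

theorem eq_zero_of_finrank_lt {k : ℕ} (hk : Module.finrank ℝ V < k) (a : V [⋀^Fin k]→L[ℝ] ℝ) :
    a = 0 := by
  ext v
  refine a.toAlternatingMap.map_linearDependent v fun h => ?_
  have := h.fintype_card_le_finrank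
  simp at this
  omega

/-- Cramer's rule: `μ u ≠ 0` makes `u` a basis, and replacing `u i` by `v` multiplies `μ u` by the
`i`-th coordinate of `v`. -/
theorem exists_expand_of_top_form {m : ℕ} (hV : Module.finrank ℝ V = m) {μ : V [⋀^Fin m]→L[ℝ] ℝ}
    {u : Fin m → V} (hu : μ u ≠ 0) (v : V) :
    v = ∑ i, (μ (Function.update u i v) / μ u) • u i := by
  have hli : LinearIndependent ℝ u := by
    by_contra h
    exact hu (μ.toAlternatingMap.map_linearDependent u h)
  let b := basisOfLinearIndependentOfCardEqFinrank' u hli (by simp [hV])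
  have hb : ∀ i, b i = u i := fun i => by simp [b]
  have hc : ∀ i, μ (Function.update u i v) = b.repr v i * μ u := by
    intro i
    conv_lhs => rw [← b.sum_repr v]
    have h1 := μ.toMultilinearMap.map_update_sum Finset.univ i (fun j => b.repr v j • b j) u
    refine h1.trans ?_
    rw [Finset.sum_eq_single i]
    · have h2 := μ.map_update_smul u i (b.repr v i) (b i)
      rw [hb, Function.update_eq_self] at h2
      rw [hb]
      exact h2
    · intro j _ hj
      have h2 := μ.map_update_smul u i (b.repr v j) (b j)
      have h3 : μ (Function.update u i (b j)) = 0 :=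
        μ.map_eq_zero_of_eq _ (by rw [hb]; simp [hj]) hj
      rw [h3, smul_zero] at h2
      exact h2
    · simp
  conv_lhs => rw [← b.sum_repr v]
  refine Finset.sum_congr rfl fun i _ => ?_
  rw [hc, hb, mul_div_cancel_right₀ _ hu]

/-- A nonzero top form is nondegenerate: vectors `x ≠ 0` and `v` on which it vanishes are
proportional. -/
theorem mem_span_of_top_form {m : ℕ} (hV : Module.finrank ℝ V = m) {μ : V [⋀^Fin m]→L[ℝ] ℝ}
    (hμ : μ ≠ 0) {x v : V} (hx : x ≠ 0)
    (h : ∀ (u : Fin m → V) (i j : Fin m), i ≠ j → u i = x → u j = v → μ u = 0) :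
    v ∈ Submodule.span ℝ {x} := by
  obtain ⟨u, hu⟩ : ∃ u, μ u ≠ 0 := by
    by_contra! h0
    exact hμ (ContinuousAlternatingMap.ext h0)
  -- Some Cramer coefficient of `x ≠ 0` is nonzero, so `x` can replace `u i` and the result is still
  -- a basis. In it, every coefficient of `v` except the one at `x` vanishes by `h`.
  obtain ⟨i, hi⟩ : ∃ i, μ (Function.update u i x) ≠ 0 := by
    by_contra! h0
    refine hx ((exists_expand_of_top_form hV hu x).trans ?_)
    simp [h0]
  have hv := exists_expand_of_top_form hV hi v
  rw [Finset.sum_eq_single i] at hv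
  · rw [hv, Function.update_self]
    exact Submodule.smul_mem _ _ (Submodule.mem_span_singleton_self x)
  · intro j _ hj
    rw [h (Function.update (Function.update u i x) j v) i j hj.symm (by simp [hj.symm]) (by simp),
      zero_div, zero_smul]
  · simp

theorem eq_zero_of_isNull_top_form {m : ℕ} (hV : Module.finrank ℝ V = m)
    {μ : V [⋀^Fin m]→L[ℝ] ℝ} (hμ : μ ≠ 0) {x : V} (h : IsNull x μ) : x = 0 := by
  obtain ⟨u, hu⟩ : ∃ u, μ u ≠ 0 := by
    by_contra! h0
    exact hμ (ContinuousAlternatingMap.ext h0)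
  rw [exists_expand_of_top_form hV hu x]
  refine Finset.sum_eq_zero fun i _ => ?_
  rw [h _ i (Function.update_self ..), zero_div, zero_smul]

omit [FiniteDimensional ℝ V] in
theorem isNull_contract_self {k : ℕ} (x : V) (a : V [⋀^Fin (k + 1)]→L[ℝ] ℝ) :
    IsNull x (contract x a) := by
  intro u i hi
  rw [contract_apply]
  exact a.map_eq_zero_of_eq (i := 0) (j := i.succ) _ (by simp [hi]) (Fin.succ_ne_zero i).symm

omit [FiniteDimensional ℝ V] in
theorem apply_eq_zero_of_isNull_contract {k : ℕ} {x v : V} {a : V [⋀^Fin (k + 1)]→L[ℝ] ℝ}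
    (h : IsNull v (contract x a)) (u : Fin (k + 1) → V) (i j : Fin (k + 1)) (hij : i ≠ j)
    (hi : u i = x) (hj : u j = v) : a u = 0 := by
  have h2 : Fin.cons x (Fin.tail (u ∘ Equiv.swap 0 i)) = u ∘ Equiv.swap 0 i := by
    conv_rhs => rw [← Fin.cons_self_tail (u ∘ Equiv.swap 0 i)]
    simp [hi]
  obtain ⟨l, hl⟩ : ∃ l : Fin k, l.succ = Equiv.swap 0 i j := by
    refine Fin.exists_succ_eq.mpr fun h0 => hij ?_
    exact ((Equiv.swap 0 i).injective (h0.trans (Equiv.swap_apply_right 0 i).symm)).symm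
  have h4 : a (u ∘ Equiv.swap 0 i) = 0 := by
    rw [← h2]
    refine h _ l ?_
    simp [Fin.tail, hl, hj]
  have h3 := a.toAlternatingMap.map_perm u (Equiv.swap 0 i)
  rw [show a.toAlternatingMap (u ∘ Equiv.swap 0 i) = 0 from h4, eq_comm, Units.smul_def] at h3
  exact (smul_eq_zero.mp h3).resolve_left (by simp)

/-- If `θⁿ = ι_y μ` with `y ≠ 0` in dimension `2n + 1`, then the kernel of `θ` is spanned
by `y`. -/
theorem contract_eq_zero_iff_of_wedgePow_eq {n : ℕ} (hV : Module.finrank ℝ V = 2 * n + 1)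
    {θ : V [⋀^Fin 2]→L[ℝ] ℝ} {μ : V [⋀^Fin (2 * n + 1)]→L[ℝ] ℝ} (hμ : μ ≠ 0) {y : V} (hy : y ≠ 0)
    (h : contract y μ = wedgePow θ n) (v : V) :
    contract v θ = 0 ↔ v ∈ Submodule.span ℝ {y} := by
  have key : ∀ v, contract v θ = 0 → v ∈ Submodule.span ℝ {y} := by
    intro v hv
    have hnull : IsNull v (contract y μ) := by
      rw [h]
      exact (isNull_of_contract_eq_zero hv).wedgePow n
    exact mem_span_of_top_form hV hμ hy (apply_eq_zero_of_isNull_contract hnull)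
  have hsmul : ∀ (c : ℝ) (v : V), contract (c • v) θ = c • contract v θ := by
    intro c v
    ext u
    have := congrArg (fun f => f u) (θ.toAlternatingMap.curryLeft.map_smul c v)
    exact this
  refine ⟨key v, fun hv => ?_⟩
  obtain ⟨c, rfl⟩ := Submodule.mem_span_singleton.mp hv
  -- Odd dimension supplies a nonzero kernel vector `w`; by `key` it is a nonzero multiple of `y`,
  -- so `y` itself lies in the kernel.
  obtain ⟨w, hw0, hw⟩ := exists_ne_zero_contract_eq_zero hV θ
  obtain ⟨e, rfl⟩ := Submodule.mem_span_singleton.mp (key w hw)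
  have he : e ≠ 0 := fun h0 => hw0 (by simp [h0])
  rw [hsmul] at hw ⊢
  rw [(smul_eq_zero.mp hw).resolve_left he, smul_zero]

/-- If `β = ι_y μ` with `y ≠ 0` and `α(y) ≠ 0`, then `α ∧ β ≠ 0`. -/
theorem wedge_contract_ne_zero {k : ℕ} (hV : Module.finrank ℝ V = k + 1)
    {α : V [⋀^Fin 1]→L[ℝ] ℝ} {μ : V [⋀^Fin (k + 1)]→L[ℝ] ℝ} (hμ : μ ≠ 0) {y : V} (hy : y ≠ 0)
    (hα : α (fun _ => y) ≠ 0) : wedge α (contract y μ) ≠ 0 := by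
  intro h0
  have h1 : contract y μ = 0 := by
    ext w
    -- The value of the wedge on `(y, w)` is `α(y)` times the value of `ι_y μ` on `w`.
    have h2 := wedge_one_left_cons α (isNull_contract_self y μ) w
    rw [h0] at h2
    exact (mul_eq_zero.mp h2.symm).resolve_left hα
  exact hy (eq_zero_of_isNull_top_form hV hμ (isNull_of_contract_eq_zero h1))

end TopForms

/-! ### Chart differentials and smoothness tested on coordinate fields. -/

section Charts

variable {m : ℕ} {M : Type*} [TopologicalSpace M] [ChartedSpace (EuclideanSpace ℝ (Fin m)) M]
  [IsManifold (𝓡 m) ∞ M]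

local notation "𝔼" => EuclideanSpace ℝ (Fin m)

instance isManifold_one : IsManifold (𝓡 m) 1 M := IsManifold.of_le (n := ∞) (by simp)

/-- The differential at `x` of the chart around `x₀`. -/
def chartDeriv (x₀ x : M) : TangentSpace (𝓡 m) x →L[ℝ] 𝔼 :=
  (trivializationAt 𝔼 (TangentSpace (𝓡 m)) x₀).continuousLinearMapAt ℝ x

/-- The differential of the inverse of the chart around `x₀`, at the image of `x`. -/
def chartDerivSymm (x₀ x : M) : 𝔼 →L[ℝ] TangentSpace (𝓡 m) x :=
  (trivializationAt 𝔼 (TangentSpace (𝓡 m)) x₀).symmL ℝ x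

theorem chartDeriv_chartDerivSymm {x₀ x : M} (hx : x ∈ (extChartAt (𝓡 m) x₀).source) (v : 𝔼) :
    chartDeriv x₀ x (chartDerivSymm x₀ x v) = v :=
  (trivializationAt 𝔼 (TangentSpace (𝓡 m)) x₀).continuousLinearMapAt_symmL (R := ℝ)
    (by simpa using hx) v

theorem chartDerivSymm_chartDeriv {x₀ x : M} (hx : x ∈ (extChartAt (𝓡 m) x₀).source)
    (v : TangentSpace (𝓡 m) x) : chartDerivSymm x₀ x (chartDeriv x₀ x v) = v :=
  (trivializationAt 𝔼 (TangentSpace (𝓡 m)) x₀).symmL_continuousLinearMapAt (R := ℝ)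
    (by simpa using hx) v

theorem mfderiv_extChartAt {x₀ x : M} (hx : x ∈ (extChartAt (𝓡 m) x₀).source) :
    mfderiv (𝓡 m) 𝓘(ℝ, 𝔼) (extChartAt (𝓡 m) x₀) x = chartDeriv x₀ x :=
  (TangentBundle.continuousLinearMapAt_trivializationAt (by simpa using hx)).symm

theorem mfderiv_extChartAt_symm {x₀ x : M} (hx : x ∈ (extChartAt (𝓡 m) x₀).source) :
    (mfderiv 𝓘(ℝ, 𝔼) (𝓡 m) (extChartAt (𝓡 m) x₀).symm (extChartAt (𝓡 m) x₀ x) : 𝔼 →L[ℝ] 𝔼) =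
      chartDerivSymm x₀ x := by
  have h := TangentBundle.symmL_trivializationAt (I := 𝓡 m) (𝕜 := ℝ) (x₀ := x₀) (x := x)
    (by simpa using hx)
  rw [ModelWithCorners.range_eq_univ, mfderivWithin_univ] at h
  exact h.symm

theorem contMDiffAt_extChartAt_symm {x₀ : M} {y : 𝔼} (hy : y ∈ (extChartAt (𝓡 m) x₀).target) :
    ContMDiffAt 𝓘(ℝ, 𝔼) (𝓡 m) ∞ (extChartAt (𝓡 m) x₀).symm y :=
  (contMDiffOn_extChartAt_symm x₀ y hy).contMDiffAt
    ((isOpen_extChartAt_target x₀).mem_nhds hy)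

theorem contMDiffAt_extChartAt_of_mem {x₀ x : M} (hx : x ∈ (extChartAt (𝓡 m) x₀).source) :
    ContMDiffAt (𝓡 m) 𝓘(ℝ, 𝔼) ∞ (extChartAt (𝓡 m) x₀) x :=
  contMDiffAt_extChartAt' (by simpa using hx)

theorem inChart_extChartAt {k : ℕ} (θ : DForm m M k) {x₀ x : M}
    (hx : x ∈ (extChartAt (𝓡 m) x₀).source) :
    inChart θ x₀ (extChartAt (𝓡 m) x₀ x) =
      (θ x).compContinuousLinearMap (chartDerivSymm x₀ x) := by
  rw [inChart, ← mfderiv_extChartAt_symm hx]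
  -- The base point returned by the inverse chart equals `x` only propositionally, so the claim is
  -- generalized to `z = x`, with the linear map typed on the model space.
  have : ∀ (z : M) (L : 𝔼 →L[ℝ] 𝔼), z = x →
      (θ z).compContinuousLinearMap (show 𝔼 →L[ℝ] TangentSpace (𝓡 m) z from L) =
        (θ x).compContinuousLinearMap (show 𝔼 →L[ℝ] TangentSpace (𝓡 m) x from L) := by
    rintro z L rfl; rfl
  exact this _ _ ((extChartAt (𝓡 m) x₀).left_inv hx)

theorem inChart_apply {k : ℕ} (θ : DForm m M k) {x₀ : M} {y : 𝔼}
    (hy : y ∈ (extChartAt (𝓡 m) x₀).target) :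
    inChart θ x₀ y = (θ ((extChartAt (𝓡 m) x₀).symm y)).compContinuousLinearMap
      (chartDerivSymm x₀ ((extChartAt (𝓡 m) x₀).symm y)) := by
  conv_lhs => rw [← (extChartAt (𝓡 m) x₀).right_inv hy]
  exact inChart_extChartAt θ ((extChartAt (𝓡 m) x₀).map_target hy)

theorem contMDiffOn_source_iff {F : Type*} [NormedAddCommGroup F] [NormedSpace ℝ F] (x₀ : M)
    (f : M → F) :
    ContMDiffOn (𝓡 m) 𝓘(ℝ, F) ∞ f (extChartAt (𝓡 m) x₀).source ↔
      ContDiffOn ℝ ∞ (f ∘ (extChartAt (𝓡 m) x₀).symm) (extChartAt (𝓡 m) x₀).target := by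
  constructor
  · intro h
    exact (h.comp (contMDiffOn_extChartAt_symm x₀)
      fun y hy => (extChartAt (𝓡 m) x₀).map_target hy).contDiffOn
  · intro h
    have h1 := h.contMDiffOn.comp (s := (extChartAt (𝓡 m) x₀).source)
      (fun x hx => (contMDiffAt_extChartAt_of_mem hx).contMDiffWithinAt)
      fun x hx => (extChartAt (𝓡 m) x₀).map_source hx
    refine h1.congr fun x hx => ?_
    exact congrArg f ((extChartAt (𝓡 m) x₀).left_inv hx).symm

theorem contMDiffOn_chartDerivSymm (x₀ : M) (v : 𝔼) :
    ContMDiffOn (𝓡 m) (𝓡 m).tangent ∞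
      (fun x => (⟨x, chartDerivSymm x₀ x v⟩ : TangentBundle (𝓡 m) M))
      (extChartAt (𝓡 m) x₀).source := by
  refine ((trivializationAt 𝔼 (TangentSpace (𝓡 m)) x₀).contMDiffOn_section_iff
    (isOpen_extChartAt_source x₀) (by simp)).mpr ?_
  refine contMDiffOn_const (c := v) |>.congr fun x hx => ?_
  have := chartDeriv_chartDerivSymm hx v
  rwa [chartDeriv, Bundle.Trivialization.continuousLinearMapAt_apply,
    Bundle.Trivialization.linearMapAt_apply, if_pos (by simpa using hx)] at this

/-- Reduces smoothness of a section of the bundle of bilinear forms to that of its coefficients on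
coordinate fields, the form in which metrics are built below. -/
theorem contMDiff_hom₂_iff (s : (x : M) →
      TangentSpace (𝓡 m) x →L[ℝ] TangentSpace (𝓡 m) x →L[ℝ] ℝ) :
    ContMDiff (𝓡 m) ((𝓡 m).prod 𝓘(ℝ, 𝔼 →L[ℝ] 𝔼 →L[ℝ] ℝ)) ∞
      (fun x => Bundle.TotalSpace.mk' (𝔼 →L[ℝ] 𝔼 →L[ℝ] ℝ)
        (E := fun x : M => TangentSpace (𝓡 m) x →L[ℝ] TangentSpace (𝓡 m) x →L[ℝ] ℝ) x (s x)) ↔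
      ∀ (x₀ : M) (v w : 𝔼), ContMDiffOn (𝓡 m) 𝓘(ℝ, ℝ) ∞
        (fun x => s x (chartDerivSymm x₀ x v) (chartDerivSymm x₀ x w))
        (extChartAt (𝓡 m) x₀).source := by
  constructor
  · intro h x₀ v w
    have h1 := ContMDiffOn.clm_bundle_apply₂ (F₁ := 𝔼) (F₂ := 𝔼) (F₃ := ℝ)
      (E₁ := fun x : M => TangentSpace (𝓡 m) x) (E₂ := fun x : M => TangentSpace (𝓡 m) x)
      (E₃ := Bundle.Trivial M ℝ) (b := fun x : M => x) (ψ := s)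
      (h.contMDiffOn (s := (extChartAt (𝓡 m) x₀).source))
      (contMDiffOn_chartDerivSymm x₀ v) (contMDiffOn_chartDerivSymm x₀ w)
    exact fun x hx => (Bundle.contMDiffWithinAt_totalSpace.mp (h1 x hx)).2
  · intro h x₀
    have hx₀ := mem_extChartAt_source (I := 𝓡 m) x₀
    refine (contMDiffAt_hom_bundle _).mpr ⟨contMDiffAt_id, ?_⟩
    have h2 : ContMDiffOn (𝓡 m) 𝓘(ℝ, 𝔼 →L[ℝ] 𝔼 →L[ℝ] ℝ) ∞
        (fun x => ContinuousLinearMap.inCoordinates 𝔼 (fun x : M => TangentSpace (𝓡 m) x)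
          (𝔼 →L[ℝ] ℝ) (fun x : M => TangentSpace (𝓡 m) x →L[ℝ] ℝ) x₀ x x₀ x (s x))
        (extChartAt (𝓡 m) x₀).source := by
      rw [contMDiffOn_source_iff, contDiffOn_clm_apply]
      intro v
      rw [contDiffOn_clm_apply]
      intro w
      refine ((contMDiffOn_source_iff x₀ _).mp (h x₀ v w)).congr fun y hy => ?_
      have hy' := (extChartAt (𝓡 m) x₀).map_target hy
      have := inCoordinates_apply_eq₂ (F₁ := 𝔼) (F₂ := 𝔼) (F₃ := ℝ)
        (E₁ := fun x : M => TangentSpace (𝓡 m) x) (E₂ := fun x : M => TangentSpace (𝓡 m) x)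
        (E₃ := Bundle.Trivial M ℝ) (x₀ := x₀) (x := (extChartAt (𝓡 m) x₀).symm y)
        (ϕ := s ((extChartAt (𝓡 m) x₀).symm y)) (v := v) (w := w)
        (by simpa using hy') (by simpa using hy') (by simp)
      have hb : (extChartAt (𝓡 m) x₀).symm y ∈
          (trivializationAt 𝔼 (TangentSpace (𝓡 m)) x₀).baseSet := by simpa using hy'
      refine this.trans ?_
      rw [Bundle.Trivialization.linearMapAt_apply, if_pos (by simp),
        ← Bundle.Trivialization.symmL_apply (R := ℝ) _ hb,
        ← Bundle.Trivialization.symmL_apply (R := ℝ) _ hb]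
      rfl
    exact (h2 x₀ hx₀).contMDiffAt (extChartAt_source_mem_nhds x₀)

theorem smoothForm_one_iff (θ : DForm m M 1) :
    SmoothForm θ ↔ ∀ (x₀ : M) (v : 𝔼), ContMDiffOn (𝓡 m) 𝓘(ℝ, ℝ) ∞
      (fun x => θ x (fun _ => chartDerivSymm x₀ x v)) (extChartAt (𝓡 m) x₀).source := by
  have h1 : ∀ x₀, ContDiffOn ℝ ∞ (inChart θ x₀) (extChartAt (𝓡 m) x₀).target ↔
      ContDiffOn ℝ ∞ (fun y =>
        (ContinuousAlternatingMap.ofSubsingletonLIE (𝕜 := ℝ) (E := 𝔼) (F := ℝ) (0 : Fin 1)).symm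
        (inChart θ x₀ y)) (extChartAt (𝓡 m) x₀).target := fun x₀ =>
    ((ContinuousAlternatingMap.ofSubsingletonLIE (𝕜 := ℝ) (E := 𝔼) (F := ℝ)
      (0 : Fin 1)).symm.toContinuousLinearEquiv.comp_contDiffOn_iff).symm
  refine forall_congr' fun x₀ => ?_
  rw [h1, contDiffOn_clm_apply]
  refine forall_congr' fun v => ?_
  rw [contMDiffOn_source_iff]
  refine contDiffOn_congr fun y hy => ?_
  rw [inChart_apply θ hy]
  rfl

end Charts

/-- Transport of a form along an equality of degrees. -/
def castDegree {V : Type*} [AddCommGroup V] [Module ℝ V] [TopologicalSpace V] {k l : ℕ}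
    (e : k = l) (a : V [⋀^Fin k]→L[ℝ] ℝ) : V [⋀^Fin l]→L[ℝ] ℝ := e ▸ a

theorem castDegree_apply {V : Type*} [AddCommGroup V] [Module ℝ V] [TopologicalSpace V] {k l : ℕ}
    (e : k = l) (a : V [⋀^Fin k]→L[ℝ] ℝ) (v : Fin l → V) :
    castDegree e a v = a (v ∘ Fin.cast e) := by
  subst e
  rfl

/-! ### The exterior derivative on a manifold. -/

section ExteriorDerivative

variable {m : ℕ} {M : Type*} [TopologicalSpace M] [ChartedSpace (EuclideanSpace ℝ (Fin m)) M]
  [IsManifold (𝓡 m) ∞ M]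

local notation "𝔼" => EuclideanSpace ℝ (Fin m)

omit [IsManifold (𝓡 m) ∞ M] in
theorem SmoothForm.differentiableAt {k : ℕ} {θ : DForm m M k} (h : SmoothForm θ) {x₀ : M} {y : 𝔼}
    (hy : y ∈ (extChartAt (𝓡 m) x₀).target) : DifferentiableAt ℝ (inChart θ x₀) y :=
  ((h x₀).contDiffAt ((isOpen_extChartAt_target x₀).mem_nhds hy)).differentiableAt (by simp)

theorem extd_eq {k : ℕ} (θ : DForm m M k) (x : M) :
    extd θ x = (extDeriv (inChart θ x) (extChartAt (𝓡 m) x x)).compContinuousLinearMap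
      (chartDeriv x x) := by
  rw [extd, mfderiv_extChartAt (mem_extChartAt_source x)]

theorem minSmoothness_two_le : minSmoothness ℝ 2 ≤ (∞ : ℕ∞ω) := by
  rw [minSmoothness_of_isRCLikeNormedField]
  exact WithTop.coe_le_coe.mpr (le_top : (2 : ℕ∞) ≤ ⊤)

/-- The exterior derivative of a smooth form can be computed in any chart. -/
theorem inChart_extd {k : ℕ} {θ : DForm m M k} (h : SmoothForm θ) {x₀ : M} {y : 𝔼}
    (hy : y ∈ (extChartAt (𝓡 m) x₀).target) :
    inChart (extd θ) x₀ y = extDeriv (inChart θ x₀) y := by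
  set x := (extChartAt (𝓡 m) x₀).symm y with hx
  have hx₀ : x ∈ (extChartAt (𝓡 m) x₀).source := (extChartAt (𝓡 m) x₀).map_target hy
  have hxx : x ∈ (extChartAt (𝓡 m) x).source := mem_extChartAt_source x
  -- The transition map from the chart at `x₀` to the chart at `x`, where `extd` is defined. Near
  -- `y`, `inChart θ x₀` is the pullback of `inChart θ x` by `τ`, and `extDeriv` commutes with
  -- pullback.
  let τ : 𝔼 → 𝔼 := fun z => extChartAt (𝓡 m) x ((extChartAt (𝓡 m) x₀).symm z)
  have hnear : ∀ᶠ z in 𝓝 y, z ∈ (extChartAt (𝓡 m) x₀).target ∧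
      (extChartAt (𝓡 m) x₀).symm z ∈ (extChartAt (𝓡 m) x).source :=
    ((isOpen_extChartAt_target x₀).mem_nhds hy |> Filter.eventually_mem_set.mpr).and
      ((contMDiffAt_extChartAt_symm hy).continuousAt.eventually
        ((isOpen_extChartAt_source x).mem_nhds hxx))
  have hτ' : ∀ z, z ∈ (extChartAt (𝓡 m) x₀).target →
      (extChartAt (𝓡 m) x₀).symm z ∈ (extChartAt (𝓡 m) x).source →
      ContMDiffAt 𝓘(ℝ, 𝔼) 𝓘(ℝ, 𝔼) ∞ τ z ∧ fderiv ℝ τ z =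
        (chartDeriv x ((extChartAt (𝓡 m) x₀).symm z)).comp
          (chartDerivSymm x₀ ((extChartAt (𝓡 m) x₀).symm z)) := by
    intro z hz hzx
    have h1 := contMDiffAt_extChartAt_of_mem hzx
    have h2 := contMDiffAt_extChartAt_symm hz
    refine ⟨h1.comp z h2, ?_⟩
    rw [← mfderiv_eq_fderiv]
    have h3 := mfderiv_comp z (h1.mdifferentiableAt (by simp)) (h2.mdifferentiableAt (by simp))
    have h4 := mfderiv_extChartAt_symm ((extChartAt (𝓡 m) x₀).map_target hz)
    rw [(extChartAt (𝓡 m) x₀).right_inv hz] at h4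
    rw [mfderiv_extChartAt hzx] at h3
    refine h3.trans ?_
    ext1 v
    exact congrArg (chartDeriv x ((extChartAt (𝓡 m) x₀).symm z))
      (congrArg (fun f : 𝔼 →L[ℝ] 𝔼 => f v) h4)
  have hpull : inChart θ x₀ =ᶠ[𝓝 y]
      fun z => (inChart θ x (τ z)).compContinuousLinearMap (fderiv ℝ τ z) := by
    filter_upwards [hnear] with z hz
    rw [inChart_apply θ hz.1, inChart_extChartAt θ hz.2, (hτ' z hz.1 hz.2).2]
    ext v
    simp only [ContinuousAlternatingMap.compContinuousLinearMap_apply]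
    congr 1
    ext1 i
    exact (chartDerivSymm_chartDeriv hz.2 _).symm
  have hτ := hτ' y hy hxx
  have hd : DifferentiableAt ℝ (inChart θ x) (τ y) :=
    h.differentiableAt ((extChartAt (𝓡 m) x).map_source hxx)
  have h5 : extDeriv (fun z => (inChart θ x (τ z)).compContinuousLinearMap (fderiv ℝ τ z)) y =
      (extDeriv (inChart θ x) (τ y)).compContinuousLinearMap (fderiv ℝ τ y) :=
    extDeriv_pullback hd hτ.1.contDiffAt minSmoothness_two_le
  rw [hpull.extDeriv_eq, h5, inChart_apply _ hy, extd_eq, hτ.2]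
  rfl

theorem SmoothForm.extd {k : ℕ} {θ : DForm m M k} (h : SmoothForm θ) : SmoothForm (extd θ) := by
  intro x₀
  have h1 : ContDiffOn ℝ ∞ (fderiv ℝ (inChart θ x₀)) (extChartAt (𝓡 m) x₀).target :=
    (h x₀).fderiv_of_isOpen (isOpen_extChartAt_target x₀) (by simp)
  have h2 := (ContinuousAlternatingMap.alternatizeUncurryFinCLM ℝ 𝔼 ℝ
    (n := k)).contDiff.comp_contDiffOn h1
  exact h2.congr fun y hy => inChart_extd h hy

omit [IsManifold (𝓡 m) ∞ M] in
theorem inChart_wedge {p q : ℕ} (a : DForm m M p) (b : DForm m M q) {x₀ : M} {y : 𝔼} :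
    inChart (fun x => wedge (a x) (b x)) x₀ y = wedge (inChart a x₀ y) (inChart b x₀ y) :=
  wedge_compContinuousLinearMap _ _ _

omit [IsManifold (𝓡 m) ∞ M] in
theorem inChart_wedgePow (θ : DForm m M 2) (n : ℕ) {x₀ : M} {y : 𝔼} :
    inChart (fun x => wedgePow (θ x) n) x₀ y = wedgePow (inChart θ x₀ y) n :=
  wedgePow_compContinuousLinearMap _ _ _

omit [IsManifold (𝓡 m) ∞ M] in
theorem SmoothForm.wedge {p q : ℕ} {a : DForm m M p} {b : DForm m M q} (ha : SmoothForm a)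
    (hb : SmoothForm b) : SmoothForm (fun x => wedge (a x) (b x)) := fun x₀ =>
  (contDiffOn_wedge (ha x₀) (hb x₀)).congr fun _ _ => inChart_wedge a b

omit [IsManifold (𝓡 m) ∞ M] in
theorem SmoothForm.wedgePow {θ : DForm m M 2} (h : SmoothForm θ) (n : ℕ) :
    SmoothForm (fun x => wedgePow (θ x) n) := fun x₀ =>
  (contDiffOn_wedgePow (h x₀) n).congr fun _ _ => inChart_wedgePow θ n

/-- The wedge powers of an exact 2-form are closed. -/
theorem extd_wedgePow_extd {α : DForm m M 1} (h : SmoothForm α) (n : ℕ) (x : M) :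
    extd (fun x => wedgePow (extd α x) n) x = 0 := by
  have hx := mem_extChartAt_target (I := 𝓡 m) x
  have h2 : inChart (extd α) x =ᶠ[𝓝 (extChartAt (𝓡 m) x x)] extDeriv (inChart α x) := by
    filter_upwards [(isOpen_extChartAt_target x).mem_nhds hx] with y hy
    exact inChart_extd h hy
  have h3 : extDeriv (inChart (extd α) x) (extChartAt (𝓡 m) x x) = 0 := by
    rw [h2.extDeriv_eq]
    exact extDeriv_extDeriv_apply ((h x).contDiffAt ((isOpen_extChartAt_target x).mem_nhds hx))
      minSmoothness_two_le
  rw [extd_eq, funext fun y => inChart_wedgePow (extd α) n (x₀ := x) (y := y),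
    extDeriv_wedgePow_eq_zero (h.extd.differentiableAt hx) h3]
  rfl

theorem SmoothForm.smul {k : ℕ} {θ : DForm m M k} (h : SmoothForm θ) {f : M → ℝ}
    (hf : ContMDiff (𝓡 m) 𝓘(ℝ, ℝ) ∞ f) : SmoothForm (fun x => f x • θ x) := fun x₀ =>
  ContDiffOn.smul ((contMDiffOn_source_iff x₀ f).mp hf.contMDiffOn) (h x₀)

omit [IsManifold (𝓡 m) ∞ M] in
theorem SmoothForm.castDegree {k l : ℕ} {θ : DForm m M k} (h : SmoothForm θ) (e : k = l) :
    SmoothForm (fun x => castDegree e (θ x)) := by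
  subst e
  exact h

end ExteriorDerivative

/-! ### Differentiation under an integral over a compact manifold. -/

section ParametricIntegral

variable {d m : ℕ} {G : Type*} [TopologicalSpace G] [ChartedSpace (EuclideanSpace ℝ (Fin d)) G]
  [IsManifold (𝓡 d) ∞ G]
  {W : Type} [NormedAddCommGroup W] [NormedSpace ℝ W]

local notation "𝔼" => EuclideanSpace ℝ (Fin m)

theorem contMDiffAt_fderiv_right {F : G → 𝔼 → W} {p : G × 𝔼}
    (h : ContMDiffAt ((𝓡 d).prod 𝓘(ℝ, 𝔼)) 𝓘(ℝ, W) ∞ (Function.uncurry F) p) :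
    ContMDiffAt ((𝓡 d).prod 𝓘(ℝ, 𝔼)) 𝓘(ℝ, 𝔼 →L[ℝ] W) ∞
      (Function.uncurry fun σ y => fderiv ℝ (F σ) y) p := by
  have h1 : ContMDiffAt (((𝓡 d).prod 𝓘(ℝ, 𝔼)).prod 𝓘(ℝ, 𝔼)) 𝓘(ℝ, W) ∞
      (Function.uncurry fun (q : G × 𝔼) (z : 𝔼) => F q.1 z) (p, p.2) :=
    ContMDiffAt.comp (p, p.2) (g := Function.uncurry F)
      (f := fun q : (G × 𝔼) × 𝔼 => (q.1.1, q.2)) h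
      ((contMDiffAt_fst.comp _ contMDiffAt_fst).prodMk contMDiffAt_snd)
  -- The point of differentiation is split off as a separate variable `z`, with the pair `(σ, y)` as
  -- parameter, and then set equal to `y`.
  have h2 := ContMDiffAt.mfderiv (fun (q : G × 𝔼) (z : 𝔼) => F q.1 z) Prod.snd h1
    (contMDiffAt_snd (n := ∞)) (by simp)
  have h3 := inTangentCoordinates_model_space (I := 𝓘(ℝ, 𝔼)) (I' := 𝓘(ℝ, W)) (Prod.snd : G × 𝔼 → 𝔼)
    (fun x => F x.1 x.2) (fun x => fderiv ℝ (F x.1) x.2) p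
  simp only [mfderiv_eq_fderiv] at h2
  exact h2.congr_of_eventuallyEq (Filter.Eventually.of_forall fun x => (congrFun h3 x).symm)

variable [CompactSpace G] [MeasurableSpace G] [BorelSpace G] (η : Measure G) [IsFiniteMeasure η]

omit [ChartedSpace (EuclideanSpace ℝ (Fin d)) G] [IsManifold (𝓡 d) ∞ G] [NormedSpace ℝ W] in
theorem integrable_of_continuous_of_compact [SecondCountableTopology W] {f : G → W}
    (hf : Continuous f) : Integrable f η := by
  borelize W
  obtain ⟨C, hC⟩ := isCompact_univ.exists_bound_of_continuousOn hf.continuousOn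
  exact Integrable.of_bound hf.aestronglyMeasurable C (Filter.Eventually.of_forall
    fun x => hC x (mem_univ x))

theorem hasFDerivAt_integral_of_contMDiffOn [SecondCountableTopology W] [CompleteSpace W]
    {U : Set 𝔼} (hU : IsOpen U) {F : G → 𝔼 → W}
    (hF : ContMDiffOn ((𝓡 d).prod 𝓘(ℝ, 𝔼)) 𝓘(ℝ, W) ∞ (Function.uncurry F) (univ ×ˢ U))
    [SecondCountableTopology (𝔼 →L[ℝ] W)] {y : 𝔼} (hy : y ∈ U) :
    HasFDerivAt (fun y => ∫ σ, F σ y ∂η) (∫ σ, fderiv ℝ (F σ) y ∂η) y := by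
  have hopen : IsOpen ((univ : Set G) ×ˢ U) := isOpen_univ.prod hU
  have hF' : ContMDiffOn ((𝓡 d).prod 𝓘(ℝ, 𝔼)) 𝓘(ℝ, 𝔼 →L[ℝ] W) ∞
      (Function.uncurry fun σ y => fderiv ℝ (F σ) y) (univ ×ˢ U) := fun p hp =>
    (contMDiffAt_fderiv_right ((hF p hp).contMDiffAt (hopen.mem_nhds hp))).contMDiffWithinAt
  have hc : ∀ z ∈ U, Continuous fun σ => F σ z := fun z hz =>
    hF.continuousOn.comp_continuous (by fun_prop : Continuous fun σ : G => (σ, z))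
      fun σ => ⟨mem_univ _, hz⟩
  have hc' : Continuous fun σ => fderiv ℝ (F σ) y :=
    hF'.continuousOn.comp_continuous (by fun_prop : Continuous fun σ : G => (σ, y))
      fun σ => ⟨mem_univ _, hy⟩
  obtain ⟨ε, hε, hball⟩ := Metric.nhds_basis_closedBall.mem_iff.mp (hU.mem_nhds hy)
  -- Compactness of `G` times a closed ball bounds the derivative uniformly, so a constant is the
  -- dominating function.
  obtain ⟨C, hC⟩ := (isCompact_univ.prod (isCompact_closedBall y ε)).exists_bound_of_continuousOn
    (hF'.continuousOn.mono (prod_mono_right hball))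
  refine hasFDerivAt_integral_of_dominated_of_fderiv_le (F := fun z σ => F σ z)
    (F' := fun z σ => fderiv ℝ (F σ) z) (bound := fun _ => C)
    (Metric.ball_mem_nhds y hε) ?_ (integrable_of_continuous_of_compact η (hc y hy))
    (hc'.aestronglyMeasurable) ?_ (integrable_const C) ?_
  · filter_upwards [hU.mem_nhds hy] with z hz
    exact (hc z hz).aestronglyMeasurable
  · exact Filter.Eventually.of_forall fun σ z hz =>
      hC (σ, z) ⟨mem_univ _, Metric.ball_subset_closedBall hz⟩
  · refine Filter.Eventually.of_forall fun σ z hz => ?_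
    have hz' := hball (Metric.ball_subset_closedBall hz)
    have h1 : ContMDiffAt 𝓘(ℝ, 𝔼) 𝓘(ℝ, W) ∞ (F σ) z :=
      ContMDiffAt.comp z (g := Function.uncurry F) (f := fun z => (σ, z))
        ((hF (σ, z) ⟨mem_univ _, hz'⟩).contMDiffAt (hopen.mem_nhds ⟨mem_univ _, hz'⟩))
        (contMDiffAt_const.prodMk contMDiffAt_id)
    exact (h1.contDiffAt.differentiableAt (by simp)).hasFDerivAt

/-- An integral over a compact manifold of a jointly smooth function depends smoothly on the
parameter. -/
theorem contDiffOn_integral_of_contMDiffOn [FiniteDimensional ℝ W]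
    {U : Set 𝔼} (hU : IsOpen U) {F : G → 𝔼 → W}
    (hF : ContMDiffOn ((𝓡 d).prod 𝓘(ℝ, 𝔼)) 𝓘(ℝ, W) ∞ (Function.uncurry F) (univ ×ˢ U)) :
    ContDiffOn ℝ ∞ (fun y => ∫ σ, F σ y ∂η) U := by
  rw [contDiffOn_infty]
  intro k
  -- The derivative of the integral is again such an integral, with values in `𝔼 →L[ℝ] W`; hence `W`
  -- has to vary in the induction.
  induction k generalizing W with
  | zero =>
    have := FiniteDimensional.proper ℝ W
    have := FiniteDimensional.proper ℝ (𝔼 →L[ℝ] W)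
    exact contDiffOn_zero.mpr fun y hy =>
      (hasFDerivAt_integral_of_contMDiffOn η hU hF hy).continuousAt.continuousWithinAt
  | succ k ih =>
    have := FiniteDimensional.proper ℝ W
    have := FiniteDimensional.proper ℝ (𝔼 →L[ℝ] W)
    have hd := fun y hy => hasFDerivAt_integral_of_contMDiffOn η hU hF (y := y) hy
    have hopen : IsOpen ((univ : Set G) ×ˢ U) := isOpen_univ.prod hU
    push_cast
    refine (contDiffOn_succ_iff_fderiv_of_isOpen hU).mpr
      ⟨fun y hy => (hd y hy).differentiableAt.differentiableWithinAt, by simp, ?_⟩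
    refine ContDiffOn.congr (f := fun y => ∫ σ, fderiv ℝ (F σ) y ∂η) (ih fun p hp => ?_)
      fun y hy => (hd y hy).fderiv
    exact (contMDiffAt_fderiv_right ((hF p hp).contMDiffAt (hopen.mem_nhds hp))).contMDiffWithinAt

end ParametricIntegral

/-! ### Construction of Riemannian metrics. -/

section Metrics

variable {m : ℕ} {M : Type*} [TopologicalSpace M] [ChartedSpace (EuclideanSpace ℝ (Fin m)) M]
  [IsManifold (𝓡 m) ∞ M]

local notation "𝔼" => EuclideanSpace ℝ (Fin m)

theorem isVonNBounded_of_pos {E : Type*} [NormedAddCommGroup E] [NormedSpace ℝ E]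
    [FiniteDimensional ℝ E] (B : E →L[ℝ] E →L[ℝ] ℝ) (hB : ∀ v, v ≠ 0 → 0 < B v v) :
    Bornology.IsVonNBounded ℝ {v : E | B v v < 1} := by
  have := FiniteDimensional.proper ℝ E
  rw [NormedSpace.isVonNBounded_iff]
  obtain ⟨c, hc, hcB⟩ : ∃ c > 0, ∀ v ∈ Metric.sphere (0 : E) 1, c ≤ B v v := by
    rcases (Metric.sphere (0 : E) 1).eq_empty_or_nonempty with h | h
    · exact ⟨1, one_pos, by simp [h]⟩
    · obtain ⟨v, hv, hmin⟩ := (isCompact_sphere (0 : E) 1).exists_isMinOn h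
        (f := fun v => B v v) (B.continuous.clm_apply continuous_id).continuousOn
      exact ⟨B v v, hB v (fun h0 => by simp [h0] at hv), fun w hw => hmin hw⟩
  -- By homogeneity `B v v ≥ c ‖v‖²`. The radius `1 / c + 1` ensures both `‖v‖ ≥ 1` and `c ‖v‖ > 1`
  -- outside the ball, hence `B v v > 1`, without square roots.
  refine (Metric.isBounded_closedBall (x := (0 : E)) (r := 1 / c + 1)).subset fun v hv => ?_
  rw [mem_closedBall_zero_iff]
  by_contra! h
  have hpos : 0 < 1 / c := by positivity
  have hv0 : 0 < ‖v‖ := by linarith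
  have h1 := hcB (‖v‖⁻¹ • v) (by simp [norm_smul, hv0.ne'])
  simp only [map_smul, smul_apply, smul_eq_mul] at h1
  have h2 : B v v < 1 := hv
  have h3 : c * (‖v‖ * ‖v‖) ≤ B v v := by
    have h4 := mul_le_mul_of_nonneg_right h1 (mul_self_nonneg ‖v‖)
    field_simp at h4
    nlinarith
  have h5 : 1 ≤ ‖v‖ := by linarith
  have h6 : 1 < c * ‖v‖ := by
    have := mul_lt_mul_of_pos_left (show 1 / c < ‖v‖ by linarith) hc
    rwa [mul_one_div_cancel hc.ne'] at this
  nlinarith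

/-- A smooth, symmetric and positive definite family of bilinear forms as a Riemannian metric. -/
def mkMetric (B : (x : M) → TangentSpace (𝓡 m) x →L[ℝ] TangentSpace (𝓡 m) x →L[ℝ] ℝ)
    (symm : ∀ x v w, B x v w = B x w v) (pos : ∀ x v, v ≠ 0 → 0 < B x v v)
    (smooth : ∀ (x₀ : M) (v w : 𝔼), ContMDiffOn (𝓡 m) 𝓘(ℝ, ℝ) ∞
      (fun x => B x (chartDerivSymm x₀ x v) (chartDerivSymm x₀ x w))
      (extChartAt (𝓡 m) x₀).source) : Metric m M where
  inner := B
  symm := symm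
  pos := pos
  isVonNBounded x := isVonNBounded_of_pos (E := 𝔼) (B x) (pos x)
  contMDiff := (contMDiff_hom₂_iff B).mpr smooth

theorem Metric.contMDiffOn_inner_section (g : Metric m M) {s : Set M} {X Y : VField m M}
    (hX : ContMDiffOn (𝓡 m) (𝓡 m).tangent ∞ (fun x => (⟨x, X x⟩ : TangentBundle (𝓡 m) M)) s)
    (hY : ContMDiffOn (𝓡 m) (𝓡 m).tangent ∞ (fun x => (⟨x, Y x⟩ : TangentBundle (𝓡 m) M)) s) :
    ContMDiffOn (𝓡 m) 𝓘(ℝ, ℝ) ∞ (fun x => g.inner x (X x) (Y x)) s := by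
  have h1 := ContMDiffOn.clm_bundle_apply₂ (F₁ := 𝔼) (F₂ := 𝔼) (F₃ := ℝ)
    (E₁ := fun x : M => TangentSpace (𝓡 m) x) (E₂ := fun x : M => TangentSpace (𝓡 m) x)
    (E₃ := Bundle.Trivial M ℝ) (b := fun x : M => x) (ψ := g.inner)
    (g.contMDiff.contMDiffOn (s := s)) hX hY
  exact fun x hx => (Bundle.contMDiffWithinAt_totalSpace.mp (h1 x hx)).2

theorem smoothForm_flat (g : Metric m M) {X : VField m M} (hX : SmoothVField X) :
    SmoothForm (flat g X) :=
  (smoothForm_one_iff _).mpr fun x₀ v =>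
    g.contMDiffOn_inner_section hX.contMDiffOn (contMDiffOn_chartDerivSymm x₀ v)

theorem contMDiffAt_chartDeriv_section {X : VField m M} {x₀ x : M}
    (hx : x ∈ (extChartAt (𝓡 m) x₀).source)
    (hX : ContMDiffAt (𝓡 m) (𝓡 m).tangent ∞ (fun x => (⟨x, X x⟩ : TangentBundle (𝓡 m) M)) x) :
    ContMDiffAt (𝓡 m) 𝓘(ℝ, 𝔼) ∞ (fun x => chartDeriv x₀ x (X x)) x := by
  refine (((trivializationAt 𝔼 (TangentSpace (𝓡 m)) x₀).contMDiffAt_section_iff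
    (by simpa using hx)).mp hX).congr_of_eventuallyEq ?_
  filter_upwards [(isOpen_extChartAt_source x₀).mem_nhds hx] with y hy
  rw [chartDeriv, Bundle.Trivialization.continuousLinearMapAt_apply,
    Bundle.Trivialization.linearMapAt_apply, if_pos (by simpa using hy)]

set_option synthInstance.maxHeartbeats 200000 in
variable (m M) in
/-- Every second countable Hausdorff manifold carries a Riemannian metric. -/
theorem exists_metric [T2Space M] [SecondCountableTopology M] : Nonempty (Metric m M) := by
  have : LocallyCompactSpace M := ChartedSpace.locallyCompactSpace 𝔼 M
  obtain ⟨f, hf⟩ := SmoothPartitionOfUnity.exists_isSubordinate_chartAt_source (𝓡 m) M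
  have hsrc : ∀ {i x}, x ∈ tsupport (f i) → x ∈ (extChartAt (𝓡 m) i).source := fun {i x} h => by
    simpa using hf i h
  -- The Euclidean inner product pulled back by the chart at `i`; a partition of unity glues these
  -- forms, and convexity of `(0, ∞)` gives positivity.
  let B (i x : M) : 𝔼 →L[ℝ] 𝔼 →L[ℝ] ℝ := (innerSL ℝ).bilinearComp
    (chartDeriv i x : 𝔼 →L[ℝ] 𝔼) (chartDeriv i x : 𝔼 →L[ℝ] 𝔼)
  have hB : ∀ i x v w, B i x v w = inner ℝ (chartDeriv i x v) (chartDeriv i x w) :=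
    fun i x v w => rfl
  have hfin : ∀ x, (Function.support fun i => f i x • B i x).Finite := fun x =>
    (f.locallyFinite.point_finite x).subset fun i hi h => hi (by
      change f i x • B i x = 0
      rw [show f i x = 0 from h]
      ext v w
      exact zero_mul (B i x v w))
  have happ : ∀ x v w, (∑ᶠ i, f i x • B i x) v w = ∑ᶠ i, f i x • B i x v w := fun x v w => by
    exact map_finsum ((ContinuousLinearMap.apply ℝ ℝ w).comp
      (ContinuousLinearMap.apply ℝ (𝔼 →L[ℝ] ℝ) v)) (hfin x)
  refine ⟨mkMetric (fun x => (∑ᶠ i, f i x • B i x : 𝔼 →L[ℝ] 𝔼 →L[ℝ] ℝ)) ?_ ?_ ?_⟩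
  · intro x v w
    refine (happ x v w).trans (Eq.trans ?_ (happ x w v).symm)
    exact finsum_congr fun i => congrArg (f i x * ·)
      ((hB i x v w).trans ((real_inner_comm _ _).trans (hB i x w v).symm))
  · intro x v hv
    refine lt_of_lt_of_eq ?_ (happ x v v).symm
    refine f.finsum_smul_mem_convex (g := fun i x => B i x v v) (mem_univ x) (t := Ioi 0)
      (fun i hi => ?_) (convex_Ioi 0)
    have hx := hsrc (subset_tsupport (f i) hi)
    refine lt_of_lt_of_eq ?_ ((hB i x v v).trans (real_inner_self_eq_norm_sq _)).symm
    have : chartDeriv i x v ≠ 0 := fun h => hv (by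
      rw [← chartDerivSymm_chartDeriv hx v, h, map_zero])
    positivity
  · intro x₀ v w x hx
    refine ContMDiffAt.contMDiffWithinAt ?_
    refine ContMDiffAt.congr_of_eventuallyEq (f := fun x => ∑ᶠ i, f i x •
      B i x (chartDerivSymm x₀ x v) (chartDerivSymm x₀ x w)) (f.contMDiffAt_finsum fun i hi => ?_)
      (Filter.Eventually.of_forall fun x => happ x _ _)
    have h := fun v => contMDiffAt_chartDeriv_section (hsrc hi)
      ((contMDiffOn_chartDerivSymm x₀ v x hx).contMDiffAt
        ((isOpen_extChartAt_source x₀).mem_nhds hx))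
    exact ContDiff.comp_contMDiffAt (g := fun p : 𝔼 × 𝔼 => inner ℝ p.1 p.2)
      contDiff_inner ((h v).prodMk_space (h w))

end Metrics

/-! ### Unimodularity of compact groups. -/

section HaarMeasure

variable {G : Type*} [Group G] [TopologicalSpace G] [IsTopologicalGroup G] [CompactSpace G]
  [MeasurableSpace G] [BorelSpace G]

/-- A right translate of `η` is again a left-invariant probability measure, and such a measure is
unique. -/
theorem isMulRightInvariant_of_compactSpace (η : Measure G) [η.IsMulLeftInvariant]
    [IsProbabilityMeasure η] : η.IsMulRightInvariant := by
  have key : ∀ (ν : Measure G) [ν.IsMulLeftInvariant] [IsProbabilityMeasure ν],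
      ν.IsHaarMeasure := fun ν _ _ =>
    Measure.isHaarMeasure_of_isCompact_nonempty_interior ν univ isCompact_univ (by simp)
      (by simp) (by simp)
  refine ⟨fun τ => ?_⟩
  have : IsProbabilityMeasure (η.map (· * τ)) :=
    Measure.isProbabilityMeasure_map (measurable_mul_const τ).aemeasurable
  have := key η
  have := key (η.map (· * τ))
  exact Measure.isHaarMeasure_eq_of_isProbabilityMeasure _ _

end HaarMeasure

/-! ### Differentials of a smooth action. -/

section Action

variable {d m : ℕ} {M : Type*} [TopologicalSpace M] [ChartedSpace (EuclideanSpace ℝ (Fin m)) M]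
  [IsManifold (𝓡 m) ∞ M]
  {G : Type*} [Group G] [TopologicalSpace G] [ChartedSpace (EuclideanSpace ℝ (Fin d)) G]
  [LieGroup (𝓡 d) ∞ G] [MulAction G M] [ContMDiffSMul (𝓡 d) (𝓡 m) ∞ G M]

local notation "𝔼" => EuclideanSpace ℝ (Fin m)

omit [IsManifold (𝓡 m) ∞ M] [LieGroup (𝓡 d) ∞ G] in
variable (d) in
include d in
theorem mdifferentiableAt_const_smul (σ : G) (x : M) :
    MDifferentiableAt (𝓡 m) (𝓡 m) (fun y : M => σ • y) x :=
  ((ContMDiffSMul.contMDiff_const_smul (I := 𝓡 d) (I' := 𝓡 m) (n := ∞) σ) x).mdifferentiableAt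
    (by simp)

omit [IsManifold (𝓡 m) ∞ M] [LieGroup (𝓡 d) ∞ G] in
variable (d) in
include d in
theorem actionDeriv_mul (σ τ : G) (x : M) (v : TangentSpace (𝓡 m) x) :
    (actionDeriv (σ * τ) x v : 𝔼) = actionDeriv σ (τ • x) (actionDeriv τ x v) := by
  have h := mfderiv_comp x (mdifferentiableAt_const_smul (m := m) d σ (τ • x))
    (mdifferentiableAt_const_smul (m := m) d τ x)
  have h2 : (fun y : M => σ • y) ∘ (fun y : M => τ • y) = fun y => (σ * τ) • y :=
    funext fun y => (mul_smul σ τ y).symm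
  rw [h2] at h
  exact congrArg (fun L : 𝔼 →L[ℝ] 𝔼 => L v) h

omit [IsManifold (𝓡 m) ∞ M] [LieGroup (𝓡 d) ∞ G] in
variable (d) in
include d in
-- The differential of `σ⁻¹` inverts that of `σ`. This keeps averaged metrics positive definite.
theorem actionDeriv_ne_zero (σ : G) (x : M) {v : TangentSpace (𝓡 m) x} (hv : v ≠ 0) :
    actionDeriv σ x v ≠ 0 := by
  intro h
  have h1 := actionDeriv_mul (m := m) d σ⁻¹ σ x v
  rw [h, map_zero] at h1
  refine hv (Eq.trans ?_ h1)
  have h2 : (fun y : M => (σ⁻¹ * σ) • y) = id := funext fun y => by simp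
  have h3 : (mfderiv (𝓡 m) (𝓡 m) (fun y : M => (σ⁻¹ * σ) • y) x : 𝔼 →L[ℝ] 𝔼) =
      ContinuousLinearMap.id ℝ 𝔼 := by
    rw [h2]; exact mfderiv_id
  exact (congrArg (fun L : 𝔼 →L[ℝ] 𝔼 => L v) h3).symm

/-- The differential of a smooth action is jointly smooth in the group element and the vector. -/
theorem contMDiffAt_actionDeriv_section {X : VField m M} {σ : G} {x : M}
    (hX : ContMDiffAt (𝓡 m) (𝓡 m).tangent ∞ (fun x => (⟨x, X x⟩ : TangentBundle (𝓡 m) M)) x) :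
    ContMDiffAt ((𝓡 d).prod (𝓡 m)) (𝓡 m).tangent ∞
      (fun p : G × M => (⟨p.1 • p.2, actionDeriv p.1 p.2 (X p.2)⟩ : TangentBundle (𝓡 m) M))
      (σ, x) := by
  have hs : ContMDiff ((𝓡 d).prod (𝓡 m)) (𝓡 m) ∞ fun p : G × M => p.1 • p.2 :=
    ContMDiffSMul.contMDiff_smul
  have h1 : ContMDiffAt (((𝓡 d).prod (𝓡 m)).prod (𝓡 m)) (𝓡 m) ∞
      (Function.uncurry fun (q : G × M) (z : M) => q.1 • z) ((σ, x), x) :=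
    hs.contMDiffAt.comp ((σ, x), x) (f := fun q : (G × M) × M => (q.1.1, q.2))
      ((contMDiffAt_fst.comp _ contMDiffAt_fst).prodMk contMDiffAt_snd)
  have : IsManifold (𝓡 d) ∞ G := inferInstance
  have h2 := ContMDiffAt.mfderiv (fun (q : G × M) (z : M) => q.1 • z) Prod.snd (x₀ := (σ, x)) h1
    (contMDiffAt_snd (n := ∞)) (m := ∞) (by simp)
  exact ContMDiffAt.clm_apply_of_inCoordinates (b₁ := fun p : G × M => p.2)
    (b₂ := fun p : G × M => p.1 • p.2) (E₁ := fun x : M => TangentSpace (𝓡 m) x)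
    (E₂ := fun x : M => TangentSpace (𝓡 m) x)
    (ϕ := fun p : G × M => actionDeriv p.1 p.2) (v := fun p => X p.2) h2
    (ContMDiffAt.comp (σ, x) (g := fun x => (⟨x, X x⟩ : TangentBundle (𝓡 m) M)) hX
      contMDiffAt_snd) hs.contMDiffAt

theorem contMDiffAt_inner_actionDeriv (g : Metric m M) {X Y : VField m M} {σ : G} {x : M}
    (hX : ContMDiffAt (𝓡 m) (𝓡 m).tangent ∞ (fun x => (⟨x, X x⟩ : TangentBundle (𝓡 m) M)) x)
    (hY : ContMDiffAt (𝓡 m) (𝓡 m).tangent ∞ (fun x => (⟨x, Y x⟩ : TangentBundle (𝓡 m) M)) x) :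
    ContMDiffAt ((𝓡 d).prod (𝓡 m)) 𝓘(ℝ, ℝ) ∞
      (fun p : G × M => g.inner (p.1 • p.2) (actionDeriv p.1 p.2 (X p.2))
        (actionDeriv p.1 p.2 (Y p.2))) (σ, x) := by
  have hs : ContMDiff ((𝓡 d).prod (𝓡 m)) (𝓡 m) ∞ fun p : G × M => p.1 • p.2 :=
    ContMDiffSMul.contMDiff_smul
  have h1 := ContMDiffAt.clm_bundle_apply₂ (F₁ := 𝔼) (F₂ := 𝔼) (F₃ := ℝ)
    (E₁ := fun x : M => TangentSpace (𝓡 m) x) (E₂ := fun x : M => TangentSpace (𝓡 m) x)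
    (E₃ := Bundle.Trivial M ℝ) (b := fun p : G × M => p.1 • p.2) (ψ := fun p => g.inner (p.1 • p.2))
    (g.contMDiff.contMDiffAt.comp (σ, x) hs.contMDiffAt)
    (contMDiffAt_actionDeriv_section hX) (contMDiffAt_actionDeriv_section hY)
  exact (Bundle.contMDiffAt_totalSpace.mp h1).2

end Action

/-! ### Averaging a metric over the group. -/

section Average

variable {d m : ℕ} {M : Type*} [TopologicalSpace M] [ChartedSpace (EuclideanSpace ℝ (Fin m)) M]
  [IsManifold (𝓡 m) ∞ M]
  {G : Type*} [Group G] [TopologicalSpace G] [ChartedSpace (EuclideanSpace ℝ (Fin d)) G]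
  [LieGroup (𝓡 d) ∞ G] [MulAction G M] [ContMDiffSMul (𝓡 d) (𝓡 m) ∞ G M]

local notation "𝔼" => EuclideanSpace ℝ (Fin m)

variable (d) in
include d in
theorem continuous_inner_actionDeriv (g : Metric m M) (x : M) (v w : TangentSpace (𝓡 m) x) :
    Continuous fun σ : G => g.inner (σ • x) (actionDeriv σ x v) (actionDeriv σ x w) := by
  have hx := mem_extChartAt_source (I := 𝓡 m) x
  -- Tangent vectors at `x` are extended to local coordinate fields, so that joint smoothness of the
  -- action on fields applies.
  have hsec := fun u => (contMDiffOn_chartDerivSymm x u x hx).contMDiffAt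
    ((isOpen_extChartAt_source x).mem_nhds hx)
  refine continuous_iff_continuousAt.mpr fun σ => ?_
  have h := ((contMDiffAt_inner_actionDeriv (d := d) (G := G) g (σ := σ)
    (hsec (chartDeriv x x v)) (hsec (chartDeriv x x w))).continuousAt).comp
    (f := fun σ : G => (σ, x)) (x := σ) (by fun_prop)
  have h' : ∀ u : TangentSpace (𝓡 m) x, chartDerivSymm x x (chartDeriv x x u) = u :=
    chartDerivSymm_chartDeriv hx
  simpa only [Function.comp_def, h'] using h

variable [CompactSpace G] [MeasurableSpace G] [BorelSpace G] (η : Measure G)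
  [IsProbabilityMeasure η]

variable (d) in
include d in
theorem integrable_inner_actionDeriv (g : Metric m M) (x : M) (v w : TangentSpace (𝓡 m) x) :
    Integrable (fun σ : G => g.inner (σ • x) (actionDeriv σ x v) (actionDeriv σ x w)) η :=
  integrable_of_continuous_of_compact η (continuous_inner_actionDeriv d g x v w)

variable (d) in
include d in
theorem contMDiffOn_integral_inner_actionDeriv (g : Metric m M) (x₀ : M) (v w : 𝔼) :
    ContMDiffOn (𝓡 m) 𝓘(ℝ, ℝ) ∞ (fun x => ∫ σ : G, g.inner (σ • x)
      (actionDeriv σ x (chartDerivSymm x₀ x v)) (actionDeriv σ x (chartDerivSymm x₀ x w)) ∂η)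
      (extChartAt (𝓡 m) x₀).source := by
  have : IsManifold (𝓡 d) ∞ G := inferInstance
  rw [contMDiffOn_source_iff]
  refine contDiffOn_integral_of_contMDiffOn (d := d) η (isOpen_extChartAt_target x₀)
    (F := fun σ y => (fun x => g.inner (σ • x) (actionDeriv σ x (chartDerivSymm x₀ x v))
      (actionDeriv σ x (chartDerivSymm x₀ x w))) ((extChartAt (𝓡 m) x₀).symm y))
    fun p hp => ContMDiffAt.contMDiffWithinAt ?_
  have hx := (extChartAt (𝓡 m) x₀).map_target hp.2
  have hsec := fun u => (contMDiffOn_chartDerivSymm x₀ u _ hx).contMDiffAt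
    ((isOpen_extChartAt_source x₀).mem_nhds hx)
  exact ContMDiffAt.comp p (f := fun p : G × 𝔼 => (p.1, (extChartAt (𝓡 m) x₀).symm p.2))
    (contMDiffAt_inner_actionDeriv g (hsec v) (hsec w))
    (contMDiffAt_fst.prodMk ((contMDiffAt_extChartAt_symm hp.2).comp p contMDiffAt_snd))

variable (d) in
include d in
/-- Averaging a Riemannian metric over a compact group acting smoothly. -/
theorem exists_isAverage (g₀ : Metric m M) : ∃ g : Metric m M, IsAverage η g₀ g := by
  have hint := fun x v w => integrable_inner_actionDeriv d η g₀ x v w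
  let P (x : M) (σ : G) : 𝔼 →L[ℝ] 𝔼 →L[ℝ] ℝ := ContinuousLinearMap.bilinearComp
    (show 𝔼 →L[ℝ] 𝔼 →L[ℝ] ℝ from g₀.inner (σ • x))
    (actionDeriv σ x : 𝔼 →L[ℝ] 𝔼) (actionDeriv σ x : 𝔼 →L[ℝ] 𝔼)
  have hP : ∀ x v w, Integrable (fun σ => P x σ v w) η := hint
  let B (x : M) : 𝔼 →ₗ[ℝ] 𝔼 →ₗ[ℝ] ℝ := LinearMap.mk₂ ℝ (fun v w => ∫ σ, P x σ v w ∂η)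
    (fun v v' w => by
      simp only [map_add, add_apply]
      exact integral_add (hP x v w) (hP x v' w))
    (fun c v w => by
      simp only [map_smul, smul_apply]
      exact integral_smul c _)
    (fun v w w' => by
      simp only [map_add]
      exact integral_add (hP x v w) (hP x v w'))
    (fun c v w => by
      simp only [map_smul]
      exact integral_smul c _)
  refine ⟨mkMetric (fun x => (B x).toContinuousBilinearMap) ?_ ?_ ?_, fun x v w => rfl⟩
  · exact fun x v w => integral_congr_ae (Filter.Eventually.of_forall fun σ => g₀.symm _ _ _)
  · intro x v hv
    have hpos : ∀ σ : G, 0 < g₀.inner (σ • x) (actionDeriv σ x v) (actionDeriv σ x v) := fun σ =>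
      g₀.pos _ _ (actionDeriv_ne_zero d σ x hv)
    refine (integral_pos_iff_support_of_nonneg (fun σ => (hpos σ).le) (hint x v v)).mpr ?_
    rw [show Function.support _ = univ from eq_univ_of_forall fun σ => (hpos σ).ne', measure_univ]
    exact one_pos
  · exact fun x₀ v w => contMDiffOn_integral_inner_actionDeriv d η g₀ x₀ v w

omit [LieGroup (𝓡 d) ∞ G] [CompactSpace G] [IsProbabilityMeasure η] in
variable (d) {η} in
include d in
-- By the chain rule, pulling back by `τ` replaces `σ` by `σ * τ` in the integrand; right invariance
-- of `η` removes the shift.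
theorem IsAverage.invariantMetric [IsTopologicalGroup G] [η.IsMulRightInvariant]
    {g₀ g : Metric m M} (h : IsAverage η g₀ g) : InvariantMetric G g := by
  intro τ x v w
  rw [h, h]
  refine Eq.trans ?_ (integral_mul_right_eq_self (μ := η) (fun σ : G => g₀.inner (σ • x)
    (actionDeriv σ x v) (actionDeriv σ x w)) τ)
  refine integral_congr_ae (Filter.Eventually.of_forall fun σ => ?_)
  have key : ∀ (z z' : M) (e : z = z') (a b : 𝔼),
      g₀.inner z (show TangentSpace (𝓡 m) z from a) (show TangentSpace (𝓡 m) z from b) =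
      g₀.inner z' (show TangentSpace (𝓡 m) z' from a) (show TangentSpace (𝓡 m) z' from b) := by
    rintro z _ rfl a b; rfl
  have h1 := fun u => actionDeriv_mul (m := m) d σ τ x u
  refine (key _ _ (mul_smul σ τ x).symm _ _).trans ?_
  exact congrArg₂ (fun a b : 𝔼 => g₀.inner ((σ * τ) • x)
    (show TangentSpace (𝓡 m) ((σ * τ) • x) from a)
    (show TangentSpace (𝓡 m) ((σ * τ) • x) from b)) (h1 v).symm (h1 w).symm

omit [TopologicalSpace G] [ChartedSpace (EuclideanSpace ℝ (Fin d)) G] [LieGroup (𝓡 d) ∞ G]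
  [ContMDiffSMul (𝓡 d) (𝓡 m) ∞ G M] [CompactSpace G] [BorelSpace G] in
variable {η} in
-- By invariance of `X` and `α`, the integrand `g₀(ρ_{σ*} X, ρ_{σ*} v)` is `α(v)` for every `σ`, and
-- `η` has total mass one.
theorem IsAverage.flat_eq {g₀ g : Metric m M} (h : IsAverage η g₀ g) {X : VField m M}
    {α : DForm m M 1} (hX : InvariantVField G X) (hα : InvariantForm G α) (h₀ : flat g₀ X = α) :
    flat g X = α := by
  funext x
  ext v
  have h1 : ∀ σ : G, g₀.inner (σ • x) (actionDeriv σ x (X x)) (actionDeriv σ x (v 0)) = α x v := by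
    intro σ
    rw [hX σ x, ← hα σ x, ← h₀]
    rfl
  change g.inner x (X x) (v 0) = α x v
  rw [h, integral_congr_ae (Filter.Eventually.of_forall h1)]
  simp

end Average

/-! ### A metric dual to a Reeb-like field. -/

section Adapted

variable {m : ℕ} {M : Type*} [TopologicalSpace M] [ChartedSpace (EuclideanSpace ℝ (Fin m)) M]
  [IsManifold (𝓡 m) ∞ M]

local notation "𝔼" => EuclideanSpace ℝ (Fin m)

instance finiteDimensional_tangentSpace (x : M) : FiniteDimensional ℝ (TangentSpace (𝓡 m) x) :=
  inferInstanceAs (FiniteDimensional ℝ 𝔼)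

omit [IsManifold (𝓡 m) ∞ M] in
theorem finrank_tangentSpace (x : M) : Module.finrank ℝ (TangentSpace (𝓡 m) x) = m :=
  finrank_euclideanSpace_fin

theorem SmoothVField.smul {X : VField m M} (hX : SmoothVField X) {f : M → ℝ}
    (hf : ContMDiff (𝓡 m) 𝓘(ℝ, ℝ) ∞ f) : SmoothVField fun x => f x • X x :=
  ContMDiff.smul_section hf hX

omit [IsManifold (𝓡 m) ∞ M] in
theorem form_one_smul (α : DForm m M 1) (x : M) (c : ℝ) (v : TangentSpace (𝓡 m) x) :
    α x (fun _ => c • v) = c * α x (fun _ => v) :=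
  ((ContinuousAlternatingMap.ofSubsingleton ℝ _ ℝ (0 : Fin 1)).symm (α x)).map_smul c v

/-- If `α (R) = 1` and `h > 0`, there is a Riemannian metric with `ι_{h R} g = α`. -/
theorem exists_metric_flat_eq [T2Space M] [SecondCountableTopology M] {α : DForm m M 1}
    {R : VField m M} {h : M → ℝ} (hα : SmoothForm α) (hR : SmoothVField R)
    (hαR : ∀ x, α x (fun _ => R x) = 1) (hh : ContMDiff (𝓡 m) 𝓘(ℝ, ℝ) ∞ h)
    (hpos : ∀ x, 0 < h x) : ∃ g : Metric m M, flat g (fun x => h x • R x) = α := by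
  obtain ⟨k⟩ := exists_metric m M
  let a (x : M) : 𝔼 →L[ℝ] ℝ := 
    (ContinuousAlternatingMap.ofSubsingleton ℝ 𝔼 ℝ (0 : Fin 1)).symm (α x)
  -- The projection onto `ker α` along `R`. It kills `h R`, so only the term `h⁻¹ α ⊗ α` of `B`
  -- contributes to `ι_{hR} B`, giving `α`.
  let P (x : M) : 𝔼 →L[ℝ] 𝔼 := ContinuousLinearMap.id ℝ 𝔼 -
    ContinuousLinearMap.smulRight (M₂ := 𝔼) (a x) (R x)
  let B (x : M) : 𝔼 →L[ℝ] 𝔼 →L[ℝ] ℝ := (a x).smulRight ((h x)⁻¹ • a x) +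
    ContinuousLinearMap.bilinearComp (show 𝔼 →L[ℝ] 𝔼 →L[ℝ] ℝ from k.inner x) (P x) (P x)
  have hB : ∀ (x : M) (v w : TangentSpace (𝓡 m) x), B x v w =
      α x (fun _ => v) * ((h x)⁻¹ * α x (fun _ => w)) +
        k.inner x (v - α x (fun _ => v) • R x) (w - α x (fun _ => w) • R x) :=
    fun x v w => rfl
  refine ⟨mkMetric B (fun x v w => ?_) (fun x v hv => ?_) (fun x₀ v w => ?_), ?_⟩
  · refine (hB x v w).trans (Eq.trans ?_ (hB x w v).symm)
    rw [k.symm]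
    ring
  · refine lt_of_lt_of_eq ?_ (hB x v v).symm
    have h1 := inv_pos.mpr (hpos x)
    rcases eq_or_ne (α x fun _ => v) 0 with h0 | h0
    · rw [h0, zero_smul, sub_zero, zero_mul, zero_add]
      exact k.pos x v hv
    · refine add_pos_of_pos_of_nonneg ?_ ?_
      · have := mul_pos h1 (mul_self_pos.mpr h0)
        linarith
      · rcases eq_or_ne (v - α x (fun _ => v) • R x) 0 with h2 | h2
        · rw [h2, map_zero]
        · exact (k.pos x _ h2).le
  · have hs := fun u => contMDiffOn_chartDerivSymm (m := m) x₀ u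
    have ha := fun u => (smoothForm_one_iff α).mp hα x₀ u
    have hsub := fun u => (hs u).sub_section ((ha u).smul_section hR.contMDiffOn)
    have hk := k.contMDiffOn_inner_section (hsub v) (hsub w)
    have hinv := (hh.inv₀ fun x => (hpos x).ne').contMDiffOn
      (s := (extChartAt (𝓡 m) x₀).source)
    exact ((ha v).mul (hinv.mul (ha w))).add hk
  · funext x
    ext v
    refine (hB x (h x • R x) (v 0)).trans ?_
    rw [form_one_smul, hαR, mul_one, sub_self, map_zero, zero_apply, add_zero,
      mul_inv_cancel_left₀ (hpos x).ne']
    exact congrArg (α x) (funext fun i => by rw [Subsingleton.elim i 0])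

end Adapted

/-! ### Contact forms and Beltrami fields. -/

section Odd

variable {n : ℕ} {M : Type*} [TopologicalSpace M]
  [ChartedSpace (EuclideanSpace ℝ (Fin (2 * n + 1))) M] [IsManifold (𝓡 (2 * n + 1)) ∞ M]

/-- The volume form `f α ∧ (dα)^n`. -/
def contactVolume (f : M → ℝ) (α : DForm (2 * n + 1) M 1) :
    DForm (2 * n + 1) M (2 * n + 1) := fun x =>
  -- The wedge has degree `1 + 2 * n`, which is not definitionally `2 * n + 1`.
  f x • castDegree (Nat.add_comm 1 (2 * n)) (wedge (α x) (wedgePow (extd α x) n))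

theorem IsContactForm.isVolumeForm {α : DForm (2 * n + 1) M 1} (h : IsContactForm α) {f : M → ℝ}
    (hf : ContMDiff (𝓡 (2 * n + 1)) 𝓘(ℝ, ℝ) ∞ f) (hf₀ : ∀ x, f x ≠ 0) :
    IsVolumeForm (contactVolume f α) := by
  refine ⟨((h.1.wedge (h.1.extd.wedgePow n)).castDegree _).smul hf, fun x h0 => h.2 x ?_⟩
  have h1 := (smul_eq_zero_iff_right (hf₀ x)).mp h0
  ext v
  have h2 := castDegree_apply (Nat.add_comm 1 (2 * n)) (wedge (α x) (wedgePow (extd α x) n))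
    (v ∘ Fin.cast (Nat.add_comm 1 (2 * n)).symm)
  rw [h1] at h2
  exact h2.symm

omit [IsManifold (𝓡 (2 * n + 1)) ∞ M] in
theorem contract_contactVolume (f : M → ℝ) (α : DForm (2 * n + 1) M 1) (x : M)
    {v : TangentSpace (𝓡 (2 * n + 1)) x} (hv : contract v (extd α x) = 0)
    (hf : f x * α x (fun _ => v) = 1) :
    contract v (contactVolume f α x) = wedgePow (extd α x) n := by
  ext w
  have h1 := wedge_one_left_cons (α x) ((isNull_of_contract_eq_zero hv).wedgePow n) w
  rw [← castDegree_apply] at h1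
  refine (congrArg (f x * ·) h1).trans ?_
  rw [← mul_assoc, hf, one_mul]

/-- A Reeb-like field is Beltrami, with its curl, for every metric with `ι_X g = α`. -/
theorem IsReebLike.exists_isNonsingularBeltrami {α : DForm (2 * n + 1) M 1}
    {X : VField (2 * n + 1) M} (h : IsReebLike α X) :
    ∃ μ : DForm (2 * n + 1) M (2 * n + 1), ∀ g : Metric (2 * n + 1) M, flat g X = α →
      IsNonsingularBeltrami g μ (fun _ => 1) X := by
  obtain ⟨hα, R, h, ⟨hR, hαR⟩, hh, hpos, hX⟩ := h
  have hαX : ∀ x, α x (fun _ => X x) = h x := fun x => by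
    rw [hX, form_one_smul, (hαR x).2, mul_one]
  have hnull : ∀ x, contract (X x) (extd α x) = 0 := fun x =>
    ((hαR x).1 _).mpr (hX x ▸ Submodule.smul_mem _ _ (Submodule.mem_span_singleton_self _))
  have hμ : interiorProduct X (contactVolume (fun x => (h x)⁻¹) α) =
      fun x => wedgePow (extd α x) n := funext fun x =>
    contract_contactVolume _ α x (hnull x) (by rw [hαX, inv_mul_cancel₀ (hpos x).ne'])
  -- The factor `h⁻¹` cancels `α(X) = h`. This volume form depends only on `α` and `X`, so it can be
  -- fixed before the averaged metric is known.
  refine ⟨contactVolume (fun x => (h x)⁻¹) α, fun g hg => ?_⟩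
  refine ⟨?_, hα.isVolumeForm (hh.inv₀ fun x => (hpos x).ne') fun x => (inv_pos.mpr (hpos x)).ne',
    fun x => ?_, fun x => ?_, fun x h0 => ?_, fun x => one_ne_zero⟩
  · rw [show X = fun x => h x • R x from funext hX]
    exact hR.smul hh
  -- In `d ι_X μ + ι_X dμ`, the first term is `d (dα)ⁿ = 0` and the second involves a form of degree
  -- above the dimension.
  · rw [lieDeriv, hμ, extd_wedgePow_extd hα.1, zero_add, interiorProduct,
      eq_zero_of_finrank_lt (by rw [finrank_tangentSpace]; omega) (extd _ x)]
    rfl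
  · simp only [one_smul, hg]
    exact congrFun hμ x
  · have h1 := hαX x
    rw [h0, (α x).map_coord_zero 0 rfl] at h1
    exact (hpos x).ne h1

/-- The form dual to a nonsingular Beltrami field is a contact form, and the field is Reeb-like
for it. -/
theorem IsNonsingularBeltrami.isReebLike {g : Metric (2 * n + 1) M}
    {μ : DForm (2 * n + 1) M (2 * n + 1)} {f : M → ℝ} {X : VField (2 * n + 1) M}
    (h : IsNonsingularBeltrami g μ f X) : IsReebLike (flat g X) X := by
  have hflat : ∀ x (v : TangentSpace (𝓡 (2 * n + 1)) x),
      flat g X x (fun _ => v) = g.inner x (X x) v := fun x v => rfl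
  have hgX : ∀ x, 0 < g.inner x (X x) (X x) := fun x => g.pos x _ (h.field_ne_zero x)
  have hy : ∀ x, f x • X x ≠ 0 := fun x => smul_ne_zero (h.factor_ne_zero x) (h.field_ne_zero x)
  have hcurl : ∀ x, contract (f x • X x) (μ x) = wedgePow (extd (flat g X) x) n := h.curl_eq
  have hsmooth : ContMDiff (𝓡 (2 * n + 1)) 𝓘(ℝ, ℝ) ∞ fun x => g.inner x (X x) (X x) :=
    contMDiffOn_univ.mp (g.contMDiffOn_inner_section h.smooth.contMDiffOn h.smooth.contMDiffOn)
  refine ⟨⟨smoothForm_flat g h.smooth, fun x => ?_⟩,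
    -- The normalization `α(R) = 1` with `α(X) = g(X, X)` forces `R = X / g(X, X)` and the factor
    -- `g(X, X)`.
    fun x => (g.inner x (X x) (X x))⁻¹ • X x, fun x => g.inner x (X x) (X x),
    ⟨h.smooth.smul (hsmooth.inv₀ fun x => (hgX x).ne'), fun x => ⟨fun v => ?_, ?_⟩⟩, hsmooth, hgX,
    fun x => ?_⟩
  · rw [← hcurl]
    refine wedge_contract_ne_zero (finrank_tangentSpace x) (h.volumeForm.2 x) (hy x) ?_
    rw [form_one_smul, hflat]
    exact mul_ne_zero (h.factor_ne_zero x) (hgX x).ne'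
  · rw [contract_eq_zero_iff_of_wedgePow_eq (finrank_tangentSpace x) (h.volumeForm.2 x) (hy x)
      (hcurl x), Submodule.span_singleton_smul_eq (h.factor_ne_zero x).isUnit,
      Submodule.span_singleton_smul_eq (inv_ne_zero (hgX x).ne').isUnit]
  · rw [form_one_smul, hflat, inv_mul_cancel₀ (hgX x).ne']
  · rw [smul_smul, mul_inv_cancel₀ (hgX x).ne', one_smul]

theorem InvariantMetric.invariantForm_flat {m : ℕ} {M : Type*} [TopologicalSpace M]
    [ChartedSpace (EuclideanSpace ℝ (Fin m)) M] [IsManifold (𝓡 m) ∞ M] {G : Type*} [SMul G M]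
    {g : Metric m M} (hg : InvariantMetric G g) {X : VField m M} (hX : InvariantVField G X) :
    InvariantForm G (flat g X) := by
  intro σ x
  ext v
  change g.inner (σ • x) (X (σ • x)) (actionDeriv σ x (v 0)) = g.inner x (X x) (v 0)
  rw [← hX, hg]

end Odd

end ReebBeltrami

end

open ReebBeltrami in
theorem theorem3p1 (n : ℕ)
    (M : Type*) [TopologicalSpace M] [T2Space M] [SecondCountableTopology M]
    [ChartedSpace (EuclideanSpace ℝ (Fin (2 * n + 1))) M] [IsManifold (𝓡 (2 * n + 1)) ∞ M]
    (d : ℕ) (G : Type*) [Group G] [TopologicalSpace G] [T2Space G] [CompactSpace G]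
    [ChartedSpace (EuclideanSpace ℝ (Fin d)) G] [LieGroup (𝓡 d) ∞ G]
    [MulAction G M] [ContMDiffSMul (𝓡 d) (𝓡 (2 * n + 1)) ∞ G M] :
    (∀ (X : VField (2 * n + 1) M) (g : Metric (2 * n + 1) M)
        (μ : DForm (2 * n + 1) M (2 * n + 1)) (f : M → ℝ),
      IsNonsingularBeltrami g μ f X → InvariantVField G X → InvariantMetric G g →
        InvariantForm G (flat g X) ∧ IsReebLike (flat g X) X) ∧
    (∀ [MeasurableSpace G] [BorelSpace G] (η : Measure G) [η.IsMulLeftInvariant]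
        [IsProbabilityMeasure η] (X : VField (2 * n + 1) M) (α : DForm (2 * n + 1) M 1),
      IsReebLike α X → InvariantVField G X → InvariantForm G α →
        ∃ (g₀ g : Metric (2 * n + 1) M) (μ : DForm (2 * n + 1) M (2 * n + 1)),
          flat g₀ X = α ∧ IsAverage η g₀ g ∧ InvariantMetric G g ∧ flat g X = α ∧
            IsNonsingularBeltrami g μ (fun _ => 1) X) := by
  refine ⟨fun X g μ f h hX hg => ⟨hg.invariantForm_flat hX, h.isReebLike⟩, ?_⟩
  intro _ _ η _ _ X α h hX hα
  obtain ⟨μ, hμ⟩ := h.exists_isNonsingularBeltrami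
  obtain ⟨hcontact, R, c, ⟨hR, hαR⟩, hc, hpos, hXR⟩ := h
  obtain ⟨g₀, hg₀⟩ := exists_metric_flat_eq hcontact.1 hR (fun x => (hαR x).2) hc hpos
  rw [← funext hXR] at hg₀
  obtain ⟨g, hg⟩ := exists_isAverage (G := G) d η g₀
  have : IsTopologicalGroup G := topologicalGroup_of_lieGroup (𝓡 d) ∞
  have := isMulRightInvariant_of_compactSpace η
  have hflat := hg.flat_eq hX hα hg₀
  exact ⟨g₀, g, μ, hg₀, hg, hg.invariantMetric d, hflat, hμ g hflat⟩
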